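/- Let $U\subseteq\mathbb R^2$ be a bounded, simply connected open set, let $m\in\mathbb N$, and let $u\in C^\infty(U,\mathbb R^m)$ be a function that is Lipschitz on $\overline U$ (i.e. its continuous extension is) and tight, and that has a principal direction field $a\in C^\infty(U,\mathbb R^2)$. Then there are $f\in C^\infty(U,\mathbb R)$ and $b,c\in C^\infty(U,\mathbb R^m)$ such that $$u(x)=f(x)\,b(x)+c(x)\qquad\text{for all }x\in U,$$ where 1. $f$ is infinity harmonic in $U$; 2. $|b|=1$ in $U$, and $b$ is constant on each flow curve of $f$; 3. $c$ is constant on each flow curve of $f$; 4. the vector field $|Df|^{-1}Df$ is a principal direction field for $u$ (in particular, $Df\neq 0$ in $U$). Here the following terms are used. For $w$ defined on a set $X$ let $\operatorname{Lip}(w,X)=\sup_{x\ne y\in X}|w(x)-w(y)|/|x-y|$, and for a Lipschitz function $w:\overline U\to\mathbb R^m$ and $x\in U$ let $\mathrm L w(x)=\inf_{r>0}\operatorname{Lip}(w,U\cap B_r(x))$. A Lipschitz function $u:\overline U\to\mathbb R^m$ is *tight* if there is no Lipschitz $v:\overline U\to\mathbb R^m$ with $v=u$ on $\partial U$ and $$\sup\{\mathrm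 L u(x): x\in U,\ \mathrm L v(x)<\mathrm L u(x)\}>\sup\{\mathrm L v(x): x\in U,\ \mathrm L v(x)>\mathrm L u(x)\},$$ where $\sup\emptyset=0$. A *principal direction field* for $u\in C^1(U,\mathbb R^m)$ is a continuous unit vector field $a$ on $U$ such that, for every $x\in U$, $a(x)$ spans the eigenspace of the largest eigenvalue of $Du(x)^tDu(x)$ (so this eigenvalue is simple). A function is *infinity harmonic* if it is a viscosity solution of $-\Delta_\infty f=0$, $\Delta_\infty f=|Df|^{-2}f_{x_i}f_{x_j}f_{x_ix_j}$ (test functions with vanishing gradient at the point of contact impose no condition). The *flow curves* of $f$ are the maximal integral curves in $U$ of the gradient field $Df$. -/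

import Mathlib

open scoped ENNReal NNReal ContDiff

noncomputable section

namespace Fan

/-- The (best) Lipschitz constant of `u` on the set `s`:
the supremum of `|u x - u y| / |x - y|` over `x, y ∈ s` (pairs with `x = y` contribute `0`). -/
def lip {n m : ℕ} (u : EuclideanSpace ℝ (Fin n) → EuclideanSpace ℝ (Fin m))
    (s : Set (EuclideanSpace ℝ (Fin n))) : ℝ≥0∞ :=
  ⨆ x ∈ s, ⨆ y ∈ s, edist (u x) (u y) / edist x y

/-- The local Lipschitz constant of `u` at `x`, relative to the domain `U`. -/
def localLip {n m : ℕ} (U : Set (EuclideanSpace ℝ (Fin n)))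
    (u : EuclideanSpace ℝ (Fin n) → EuclideanSpace ℝ (Fin m))
    (x : EuclideanSpace ℝ (Fin n)) : ℝ≥0∞ :=
  ⨅ (r : ℝ) (_ : 0 < r), lip u (U ∩ Metric.ball x r)

/-- `u` is a Lipschitz function on the closure of `U` (its values elsewhere are irrelevant). -/
def IsLipschitzOnClosure {n m : ℕ} (U : Set (EuclideanSpace ℝ (Fin n)))
    (u : EuclideanSpace ℝ (Fin n) → EuclideanSpace ℝ (Fin m)) : Prop :=
  ∃ K : ℝ≥0, LipschitzOnWith K u (closure U)

/-- `v` is tighter than `u` on `U`: both are Lipschitz on the closure of `U`, they agree on the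
boundary of `U`, and `sup {L u : L v < L u} > sup {L v : L v > L u}`. -/
structure IsTighter {n m : ℕ} (U : Set (EuclideanSpace ℝ (Fin n)))
    (v u : EuclideanSpace ℝ (Fin n) → EuclideanSpace ℝ (Fin m)) : Prop where
  lipschitz_left : IsLipschitzOnClosure U v
  lipschitz_right : IsLipschitzOnClosure U u
  eq_boundary : ∀ x ∈ frontier U, v x = u x
  sup_lt : sSup (localLip U v '' {x ∈ U | localLip U u x < localLip U v x}) <
    sSup (localLip U u '' {x ∈ U | localLip U v x < localLip U u x})

/-- A Lipschitz function `u` is tight on `U` if there is no tighter `v`. -/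
def IsTight {n m : ℕ} (U : Set (EuclideanSpace ℝ (Fin n)))
    (u : EuclideanSpace ℝ (Fin n) → EuclideanSpace ℝ (Fin m)) : Prop :=
  IsLipschitzOnClosure U u ∧
    ¬ ∃ v : EuclideanSpace ℝ (Fin n) → EuclideanSpace ℝ (Fin m), IsTighter U v u

/-- The operator `Du(x)ᵗ Du(x)` on `ℝⁿ`. -/
def gram {n m : ℕ} (u : EuclideanSpace ℝ (Fin n) → EuclideanSpace ℝ (Fin m))
    (x : EuclideanSpace ℝ (Fin n)) : Module.End ℝ (EuclideanSpace ℝ (Fin n)) :=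
  ((ContinuousLinearMap.adjoint (fderiv ℝ u x)).comp (fderiv ℝ u x) :
    EuclideanSpace ℝ (Fin n) →L[ℝ] EuclideanSpace ℝ (Fin n))

/-- A principal direction field for `u` on `U`: a continuous unit vector field `a` such that `a x`
spans the principal eigenspace (the eigenspace of the largest eigenvalue) of `Du(x)ᵗ Du(x)`
for every `x ∈ U`. -/
structure IsPrincipalDirectionField {n m : ℕ} (U : Set (EuclideanSpace ℝ (Fin n)))
    (u : EuclideanSpace ℝ (Fin n) → EuclideanSpace ℝ (Fin m))
    (a : EuclideanSpace ℝ (Fin n) → EuclideanSpace ℝ (Fin n)) : Prop where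
  continuousOn : ContinuousOn a U
  norm_eq_one : ∀ x ∈ U, ‖a x‖ = 1
  spans : ∀ x ∈ U, ∃ μ : ℝ, IsGreatest {ν : ℝ | (gram u x).HasEigenvalue ν} μ ∧
    (gram u x).eigenspace μ = Submodule.span ℝ {a x}

/-- The infinity Laplacian `|Dφ|⁻² φ_{x_i} φ_{x_j} φ_{x_i x_j}`. It is read as `0` where `Dφ = 0`,
so that test functions with vanishing gradient impose no condition in `IsInfinityHarmonic`,
exactly as for the operator without the factor `|Dφ|⁻²`. -/
def infLaplacian {n : ℕ} (φ : EuclideanSpace ℝ (Fin n) → ℝ) (x : EuclideanSpace ℝ (Fin n)) : ℝ :=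
  (‖gradient φ x‖ ^ 2)⁻¹ * fderiv ℝ (fderiv ℝ φ) x (gradient φ x) (gradient φ x)

/-- `f` is infinity harmonic in the open set `U`: a viscosity solution of `-Δ_∞ f = 0` in `U`. -/
structure IsInfinityHarmonic {n : ℕ} (U : Set (EuclideanSpace ℝ (Fin n)))
    (f : EuclideanSpace ℝ (Fin n) → ℝ) : Prop where
  continuousOn : ContinuousOn f U
  subsolution : ∀ x ∈ U, ∀ φ : EuclideanSpace ℝ (Fin n) → ℝ, ContDiffAt ℝ 2 φ x →
    IsLocalMax (fun y => f y - φ y) x → 0 ≤ infLaplacian φ x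
  supersolution : ∀ x ∈ U, ∀ φ : EuclideanSpace ℝ (Fin n) → ℝ, ContDiffAt ℝ 2 φ x →
    IsLocalMin (fun y => f y - φ y) x → infLaplacian φ x ≤ 0

/-- `g` is constant on each flow curve of `f`, that is, along every integral curve `γ : I → U` of
`Df` on an open interval `I`. (Every such curve is part of a maximal one, so this is the same as
being constant on the maximal curves.) -/
def ConstOnFlowCurves {n m : ℕ} (U : Set (EuclideanSpace ℝ (Fin n)))
    (f : EuclideanSpace ℝ (Fin n) → ℝ)
    (g : EuclideanSpace ℝ (Fin n) → EuclideanSpace ℝ (Fin m)) : Prop :=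
  ∀ (I : Set ℝ) (γ : ℝ → EuclideanSpace ℝ (Fin n)), IsOpen I → I.OrdConnected →
    (∀ t ∈ I, γ t ∈ U ∧ HasDerivAt γ (gradient f (γ t)) t) →
    ∀ s ∈ I, ∀ t ∈ I, g (γ s) = g (γ t)

/-- `u = f b + c` on `U` is a presentation of `u` as a smooth infinity harmonic fan. -/
structure IsInfinityHarmonicFan {n m : ℕ} (U : Set (EuclideanSpace ℝ (Fin n)))
    (u : EuclideanSpace ℝ (Fin n) → EuclideanSpace ℝ (Fin m))
    (f : EuclideanSpace ℝ (Fin n) → ℝ)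
    (b c : EuclideanSpace ℝ (Fin n) → EuclideanSpace ℝ (Fin m)) : Prop where
  eq_fan : ∀ x ∈ U, u x = f x • b x + c x
  smooth_f : ContDiffOn ℝ ∞ f U
  infinityHarmonic : IsInfinityHarmonic U f
  smooth_b : ContDiffOn ℝ ∞ b U
  norm_b : ∀ x ∈ U, ‖b x‖ = 1
  const_b : ConstOnFlowCurves U f b
  smooth_c : ContDiffOn ℝ ∞ c U
  const_c : ConstOnFlowCurves U f c
  principal : IsPrincipalDirectionField U u (fun x => ‖gradient f x‖⁻¹ • gradient f x)

end Fan

end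

/-!
Write `p = Du a` for the derivative of `u` along its principal direction, so that `‖Du‖ = |p|` and
`Du a ⟂ Du a⊥`, where `a⊥` is `a` turned by a right angle. The local Lipschitz constant of a `C¹`
function is the operator norm of its derivative (`Fan.localLip_eq_enorm_fderiv`).

*Tightness gives `D_a p = 0`.* As the largest singular value is simple, the perturbation `u + ε w`
satisfies `‖D(u + ε w)‖² ≤ ‖Du‖² + 2 ε ⟪p, D_a w⟫ + C ε² ‖Dw‖²`, locally uniformly
(`Fan.exists_norm_add_sq_le`). For `w = F₊² e` the error term is of order `ε² F₊²`, while the first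
order term is `2 ε F₊ (2 (D_a F) ⟪p, e⟫ + F₊ ⟪p, D_a e⟫)`; it therefore suffices to control the sign
of the latter (`Fan.not_isTight_of_bumpField`). With `e = p / |p|²` and
`F = δ - (|p|² - |p(x₀)|²) - K |x - x₀|²` this excludes `D_a |p|² > 0` at `x₀`: in the part of
`{F > 0}` where `F` is not decreasing along `a`, the norm `‖Du‖` is smaller than at `x₀`
(`Fan.inner_dirDeriv_nonpos`). Replacing `a` by `-a` gives `⟪p, D_a p⟫ = 0`, and then `e = D_a p`
satisfies `⟪p, e⟫ = 0` and `⟪p, D_a e⟫ = -|e|²`, so a bump in this direction lowers `‖Du‖` on all of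
its support unless `D_a p = 0` (`Fan.dirDeriv_dirDeriv_eq_zero`).

*The equation gives the fan.* Put `b = p / |p|`; then `D_a b = 0`. The 1-form
`⟪b, Du ·⟫ = |p| ⟪a, ·⟫` is closed, because its exterior derivative on the pair `(a, a⊥)` is
`⟪D_a b, Du a⊥⟫ - ⟪D_{a⊥} b, p⟫ = 0`. On a simply connected open set a closed 1-form is exact
(`exists_hasFDerivAt_of_isSimplyConnected`), which yields `f` with `Df = |p| a`. Finally `f` is
infinity harmonic since `|Df| = |p|` is constant along `Df`, and `c = u - f b` satisfies
`D_a c = p - |p| b = 0` (`Fan.exists_isInfinityHarmonicFan`).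
-/

open Topology

/-! ### Closed 1-forms on simply connected open sets -/

/-- A copy of `F` carrying the discrete topology; it serves as the fibre of the covering space of
local primitives of a closed 1-form. -/
def DiscreteCopy (F : Type*) : Type _ := F

instance (F : Type*) : TopologicalSpace (DiscreteCopy F) := ⊥

instance (F : Type*) : DiscreteTopology (DiscreteCopy F) := ⟨rfl⟩

/-- Translation of a point of the discrete fibre by a vector. -/
def DiscreteCopy.translate {F : Type*} [AddCommGroup F] (c : F) (v : DiscreteCopy F) :
    DiscreteCopy F :=
  Add.add (α := F) v c

theorem DiscreteCopy.translate_zero {F : Type*} [AddCommGroup F] (v : DiscreteCopy F) :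
    v.translate 0 = v :=
  add_zero (M := F) v

theorem DiscreteCopy.translate_translate {F : Type*} [AddCommGroup F] (c d : F)
    (v : DiscreteCopy F) : (v.translate c).translate d = v.translate (c + d) :=
  add_assoc (G := F) v c d

/-- The covering space of local primitives: `g i` is a primitive of a fixed 1-form on the convex
open set `s i`, and a point over `x` in the chart `i` is a constant `v`, standing for the germ at
`x` of the primitive `g i + v`. -/
def primitiveCore {E F : Type*} [NormedAddCommGroup E] [NormedSpace ℝ E] [NormedAddCommGroup F]
    [NormedSpace ℝ F] {U : Set E} (θ : E → E →L[ℝ] F) (s : U → Set E) (g : U → E → F)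
    (hs : ∀ i, IsOpen (s i)) (hconv : ∀ i, Convex ℝ (s i)) (hmem : ∀ i : U, (i : E) ∈ s i)
    (hg : ∀ i, ∀ x ∈ s i, HasFDerivAt (g i) (θ x) x) :
    FiberBundleCore U U (DiscreteCopy F) where
  baseSet i := Subtype.val ⁻¹' s i
  isOpen_baseSet i := (hs i).preimage continuous_subtype_val
  indexAt := id
  mem_baseSet_at x := hmem x
  coordChange i j x v := v.translate (g i x - g j x)
  coordChange_self i x _ v := by rw [sub_self, DiscreteCopy.translate_zero]
  continuousOn_coordChange i j := by
    rintro ⟨x, v⟩ ⟨⟨hxi, hxj⟩, -⟩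
    have hd : ∀ y ∈ s i ∩ s j, HasFDerivAt (fun z => g i z - g j z) (0 : E →L[ℝ] F) y := by
      intro y hy
      simpa using (hg i y hy.1).fun_sub (hg j y hy.2)
    have ho : IsOpen (s i ∩ s j) := (hs i).inter (hs j)
    have hc : ∀ y ∈ s i ∩ s j, g i y - g j y = g i x - g j x := fun y hy =>
      ho.is_const_of_fderiv_eq_zero ((hconv i).inter (hconv j)).isPreconnected
        (fun z hz => (hd z hz).differentiableAt.differentiableWithinAt)
        (fun z hz => (hd z hz).fderiv) hy ⟨hxi, hxj⟩
    have hcont : Continuous (fun p : U × DiscreteCopy F => p.2.translate (g i x - g j x)) :=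
      (continuous_of_discreteTopology
        (f := DiscreteCopy.translate (g i x - g j x))).comp continuous_snd
    refine hcont.continuousOn.congr (fun p hp => ?_) _ ⟨⟨hxi, hxj⟩, trivial⟩
    change p.2.translate _ = p.2.translate _
    rw [hc p.1 hp.1]
  coordChange_comp i j k x _ v := by
    rw [DiscreteCopy.translate_translate, sub_add_sub_cancel]

/-- Poincaré lemma for simply connected open sets: the identity of `U` lifts to the covering space
of local primitives, and the lift is a global primitive. -/
theorem exists_hasFDerivAt_of_isSimplyConnected {E F : Type*} [NormedAddCommGroup E]
    [NormedSpace ℝ E] [NormedAddCommGroup F] [NormedSpace ℝ F] [CompleteSpace F] {U : Set E}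
    (hU : IsOpen U) (hUsc : IsSimplyConnected U) {θ : E → E →L[ℝ] F}
    (hθ : DifferentiableOn ℝ θ U)
    (hsymm : ∀ x ∈ U, ∀ h k, fderiv ℝ θ x h k = fderiv ℝ θ x k h) :
    ∃ f : E → F, ∀ x ∈ U, HasFDerivAt f (θ x) x := by
  classical
  have := hUsc.simplyConnectedSpace
  have := hU.locallyPathConnectedSpace
  choose r hr0 hr using fun i : U => Metric.isOpen_iff.1 hU i i.2
  choose g hg using fun i : U =>
    (convex_ball (i : E) (r i)).exists_forall_hasFDerivAt_of_fderiv_symmetric Metric.isOpen_ball (hθ.mono (hr i)) (fun x hx => hsymm x (hr i hx))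
  let Z := primitiveCore θ (fun i : U => Metric.ball (i : E) (r i)) g (fun _ => Metric.isOpen_ball)
    (fun i => convex_ball _ _) (fun i => Metric.mem_ball_self (hr0 i)) hg
  have hcov : IsCoveringMap (Bundle.TotalSpace.proj : Z.TotalSpace → U) :=
    FiberBundle.isCoveringMap (F := DiscreteCopy F) (E := Z.Fiber)
  obtain ⟨x₀, hx₀⟩ := hUsc.nonempty
  obtain ⟨σ, ⟨-, hσ⟩, -⟩ := hcov.existsUnique_continuousMap_lifts (ContinuousMap.id U) ⟨x₀, hx₀⟩
    (⟨⟨x₀, hx₀⟩, (0 : F)⟩ : Z.TotalSpace) rfl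
  have hproj : ∀ y : U, (σ y).proj = y := fun y => congrFun hσ y
  let v : U → F := fun y => (σ y).2
  refine ⟨fun x => if hx : x ∈ U then v ⟨x, hx⟩ + g ⟨x, hx⟩ x else 0, fun x hx => ?_⟩
  -- the coordinate of the lift in the chart centred at `x` is locally constant
  let i : U := ⟨x, hx⟩
  let c : U → F := fun y => (v y + (g y y - g i y) : F)
  have hc : ∀ y : U, ((Z.localTriv i) (σ y)).2 = c y := by
    intro y
    rw [FiberBundleCore.localTriv_apply]
    change (v y + (g (σ y).proj (σ y).proj - g i (σ y).proj) : F) = _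
    rw [hproj]
  have hcont : ContinuousAt (fun y : U => ((Z.localTriv i) (σ y)).2) i := by
    have h1 : ContinuousAt (Z.localTriv i) (σ i) := by
      apply (Z.localTriv i).continuousAt
      rw [(Z.localTriv i).mem_source]
      change ((σ i).proj : E) ∈ Metric.ball (i : E) (r i)
      rw [hproj]
      exact Metric.mem_ball_self (hr0 i)
    exact continuousAt_snd.comp (ContinuousAt.comp h1 σ.continuous.continuousAt)
  have hloc : ∀ᶠ y in 𝓝 i, c y = c i := by
    have := hcont (IsOpen.mem_nhds (isOpen_discrete {((Z.localTriv i) (σ i)).2}) rfl)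
    filter_upwards [this] with y hy
    rw [← hc, ← hc]
    exact hy
  have hev : (fun x => if hx : x ∈ U then v ⟨x, hx⟩ + g ⟨x, hx⟩ x else 0) =ᶠ[𝓝 x]
      fun y => c i + g i y := by
    have h2 : ∀ᶠ y in 𝓝[U] x, ∃ hy : y ∈ U, c ⟨y, hy⟩ = c i := by
      rw [nhdsWithin_eq_map_subtype_coe hx, Filter.eventually_map]
      filter_upwards [hloc] with y hy
      exact ⟨y.2, hy⟩
    rw [hU.nhdsWithin_eq hx] at h2
    filter_upwards [h2] with y ⟨hy, hcy⟩
    rw [dif_pos hy, ← hcy]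
    simp only [c]
    abel
  exact (((hg i x (Metric.mem_ball_self (hr0 i)))).const_add _).congr_of_eventuallyEq hev

/-! ### Local Lipschitz constants -/

namespace Fan

variable {n m : ℕ} {U : Set (EuclideanSpace ℝ (Fin n))}
  {u v : EuclideanSpace ℝ (Fin n) → EuclideanSpace ℝ (Fin m)} {x : EuclideanSpace ℝ (Fin n)}

theorem lip_le_of_lipschitzOnWith {s : Set (EuclideanSpace ℝ (Fin n))} {K : ℝ≥0}
    (h : LipschitzOnWith K u s) : lip u s ≤ K := by
  refine iSup₂_le fun y hy => iSup₂_le fun z hz => ?_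
  exact ENNReal.div_le_of_le_mul (h hy hz)

theorem lipschitzOnWith_of_lip_le {s : Set (EuclideanSpace ℝ (Fin n))} {K : ℝ≥0}
    (h : lip u s ≤ K) : LipschitzOnWith K u s := by
  intro y hy z hz
  have h1 : edist (u y) (u z) / edist y z ≤ K :=
    ((le_iSup₂ (f := fun z (_ : z ∈ s) => edist (u y) (u z) / edist y z) z hz).trans
      (le_iSup₂ (f := fun y (_ : y ∈ s) => ⨆ z ∈ s, edist (u y) (u z) / edist y z) y hy)).trans h
  by_cases hyz : y = z
  · simp [hyz]
  · exact (ENNReal.div_le_iff (by simpa using hyz) (edist_ne_top _ _)).1 h1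

theorem localLip_eq_enorm_fderiv (hU : IsOpen U) (hx : x ∈ U) (hu : ContDiffAt ℝ 1 u x) :
    localLip U u x = ‖fderiv ℝ u x‖ₑ := by
  apply le_antisymm
  · refine ENNReal.le_of_forall_pos_le_add fun ε hε _ => ?_
    have hd : ∀ᶠ y in 𝓝 x, DifferentiableAt ℝ u y :=
      (hu.eventually (by simp)).mono fun y hy => hy.differentiableAt (by simp)
    have hc : ∀ᶠ y in 𝓝 x, ‖fderiv ℝ u y‖₊ < ‖fderiv ℝ u x‖₊ + ε := by
      have : ContinuousAt (fun y => ‖fderiv ℝ u y‖₊) x :=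
        ((hu.fderiv_right (m := 0) (by simp)).continuousAt).nnnorm
      exact this.eventually_lt_const (lt_add_of_pos_right _ hε)
    obtain ⟨r, hr, hball⟩ := Metric.eventually_nhds_iff_ball.1 (hd.and hc)
    have hL : LipschitzOnWith (‖fderiv ℝ u x‖₊ + ε) u (Metric.ball x r) :=
      Convex.lipschitzOnWith_of_nnnorm_fderiv_le (fun y hy => (hball y hy).1)
        (fun y hy => (hball y hy).2.le) (convex_ball x r)
    refine (iInf₂_le r hr).trans ?_
    refine (lip_le_of_lipschitzOnWith (hL.mono Set.inter_subset_right)).trans ?_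
    simp [enorm]
  · refine le_iInf₂ fun r hr => ?_
    rcases eq_or_ne (lip u (U ∩ Metric.ball x r)) ⊤ with h | h
    · simp [h]
    lift lip u (U ∩ Metric.ball x r) to ℝ≥0 using h with K hK
    have := norm_fderiv_le_of_lipschitzOn ℝ
      (Filter.inter_mem (hU.mem_nhds hx) (Metric.ball_mem_nhds x hr))
      (lipschitzOnWith_of_lip_le hK.ge)
    rw [enorm_le_coe]
    exact this

/-- A function is not tight if a compactly supported `C¹` perturbation strictly decreases
`‖Du‖` at some point `x`, and wherever it increases `‖Du‖`, the new value stays below a number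
`t < ‖Du x‖`. -/
theorem not_isTight_of_perturbation (hU : IsOpen U) (hu : ContDiffOn ℝ 1 u U)
    {w : EuclideanSpace ℝ (Fin n) → EuclideanSpace ℝ (Fin m)} (hw : ContDiff ℝ 1 w)
    (hwc : HasCompactSupport w) (hwU : tsupport w ⊆ U) {t : ℝ} (hx : x ∈ U)
    (ht : t < ‖fderiv ℝ u x‖)
    (hdec : ‖fderiv ℝ (fun y => u y + w y) x‖ < ‖fderiv ℝ u x‖)
    (hinc : ∀ y ∈ U, ‖fderiv ℝ u y‖ < ‖fderiv ℝ (fun y => u y + w y) y‖ →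
      ‖fderiv ℝ (fun y => u y + w y) y‖ ≤ t) : ¬ IsTight U u := by
  rintro ⟨⟨K, hK⟩, hnot⟩
  apply hnot
  have hLu : ∀ y ∈ U, localLip U u y = ENNReal.ofReal ‖fderiv ℝ u y‖ := fun y hy => by
    rw [localLip_eq_enorm_fderiv hU hy (hu.contDiffAt (hU.mem_nhds hy)), ofReal_norm]
  have hLv : ∀ y ∈ U, localLip U (fun y => u y + w y) y =
      ENNReal.ofReal ‖fderiv ℝ (fun y => u y + w y) y‖ := fun y hy => by
    rw [localLip_eq_enorm_fderiv hU hy ((hu.contDiffAt (hU.mem_nhds hy)).add hw.contDiffAt),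
      ofReal_norm]
  refine ⟨fun y => u y + w y, ?_, ⟨K, hK⟩, fun y hy => ?_, ?_⟩
  · obtain ⟨C, hC⟩ := hw.lipschitzWith_of_hasCompactSupport hwc one_ne_zero
    exact ⟨K + C, hK.add hC.lipschitzOnWith⟩
  · have : y ∉ tsupport w := fun h => by
      rw [hU.frontier_eq] at hy
      exact hy.2 (hwU h)
    simp [image_eq_zero_of_notMem_tsupport this]
  · refine lt_of_le_of_lt (b := ENNReal.ofReal t) (sSup_le ?_) (lt_of_lt_of_le
      ((ENNReal.ofReal_lt_ofReal_iff ((norm_nonneg _).trans_lt hdec)).2 ht)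
      (le_sSup ⟨x, ⟨hx, ?_⟩, hLu x hx⟩))
    · rintro _ ⟨y, ⟨hy, hlt⟩, rfl⟩
      rw [hLv y hy]
      rw [hLv y hy, hLu y hy] at hlt
      exact ENNReal.ofReal_le_ofReal (hinc y hy (lt_of_not_ge fun h =>
        hlt.not_ge (ENNReal.ofReal_le_ofReal h)))
    · rw [hLv x hx, hLu x hx]
      exact (ENNReal.ofReal_lt_ofReal_iff ((norm_nonneg _).trans_lt hdec)).2 hdec

end Fan

/-! ### Principal directions of linear maps from the plane -/

namespace Fan

/-- Rotation of the plane by a right angle. -/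
noncomputable def rot : EuclideanSpace ℝ (Fin 2) →L[ℝ] EuclideanSpace ℝ (Fin 2) :=
  LinearMap.toContinuousLinearMap
    { toFun := fun v => !₂[-v 1, v 0]
      map_add' := fun v w => by
        ext i
        fin_cases i <;> simp [add_comm]
      map_smul' := fun c v => by
        ext i
        fin_cases i <;> simp }

theorem rot_apply (v : EuclideanSpace ℝ (Fin 2)) : rot v = !₂[-v 1, v 0] := rfl

theorem inner_rot_self (v : EuclideanSpace ℝ (Fin 2)) : inner ℝ v (rot v) = 0 := by
  simp [rot_apply, PiLp.inner_apply, Fin.sum_univ_two]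
  ring

theorem sq_add_sq_of_norm_eq_one {a : EuclideanSpace ℝ (Fin 2)} (ha : ‖a‖ = 1) :
    a 0 ^ 2 + a 1 ^ 2 = 1 := by
  have := EuclideanSpace.real_norm_sq_eq a
  rw [ha, Fin.sum_univ_two] at this
  linarith

theorem eq_inner_smul_add_inner_rot_smul {a : EuclideanSpace ℝ (Fin 2)} (ha : ‖a‖ = 1)
    (v : EuclideanSpace ℝ (Fin 2)) : v = inner ℝ a v • a + inner ℝ (rot a) v • rot a := by
  have h := sq_add_sq_of_norm_eq_one ha
  ext i
  fin_cases i
  · simp [rot_apply, PiLp.inner_apply, Fin.sum_univ_two]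
    linear_combination (-v 0) * h
  · simp [rot_apply, PiLp.inner_apply, Fin.sum_univ_two]
    linear_combination (-v 1) * h

theorem norm_sq_eq_inner_sq_add_inner_rot_sq {a : EuclideanSpace ℝ (Fin 2)} (ha : ‖a‖ = 1)
    (v : EuclideanSpace ℝ (Fin 2)) : ‖v‖ ^ 2 = inner ℝ a v ^ 2 + inner ℝ (rot a) v ^ 2 := by
  have h := sq_add_sq_of_norm_eq_one ha
  rw [EuclideanSpace.real_norm_sq_eq v]
  simp [rot_apply, PiLp.inner_apply, Fin.sum_univ_two]
  linear_combination (-(v 0) ^ 2 - v 1 ^ 2) * h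

theorem norm_rot (v : EuclideanSpace ℝ (Fin 2)) : ‖rot v‖ = ‖v‖ := by
  rw [← sq_eq_sq₀ (norm_nonneg _) (norm_nonneg _), EuclideanSpace.real_norm_sq_eq,
    EuclideanSpace.real_norm_sq_eq]
  simp [rot_apply, Fin.sum_univ_two, add_comm]

/-- The unit vector `a` is a strict principal direction of `L`: together with `rot a` it is a pair
of singular directions, and the singular value in the direction `a` is the larger one. -/
structure IsPrincipalDirection {m : ℕ}
    (L : EuclideanSpace ℝ (Fin 2) →L[ℝ] EuclideanSpace ℝ (Fin m))
    (a : EuclideanSpace ℝ (Fin 2)) : Prop where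
  norm_eq_one : ‖a‖ = 1
  inner_eq_zero : inner ℝ (L a) (L (rot a)) = 0
  norm_lt : ‖L (rot a)‖ < ‖L a‖

variable {m : ℕ} {L : EuclideanSpace ℝ (Fin 2) →L[ℝ] EuclideanSpace ℝ (Fin m)}
  {a : EuclideanSpace ℝ (Fin 2)}

theorem IsPrincipalDirection.neg (h : IsPrincipalDirection L a) : IsPrincipalDirection L (-a) where
  norm_eq_one := by rw [norm_neg, h.norm_eq_one]
  inner_eq_zero := by simpa using h.inner_eq_zero
  norm_lt := by simpa using h.norm_lt

/-- The mixed terms of a perturbed quadratic form are absorbed by the gap `γ`. -/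
theorem mixed_terms_le {A B C D W c s γ : ℝ} (hγ : 0 < γ) (hA : |A| ≤ W) (hB : |B| ≤ W)
    (hC : |C| ≤ W) (hD : |D| ≤ W) :
    2 * (-s ^ 2 * A + c * s * (B + C) + s ^ 2 * D) ≤
      γ * s ^ 2 + 16 * W ^ 2 / γ * (c ^ 2 + s ^ 2) := by
  rw [abs_le] at hA hB hC hD
  have h1 : c * s * (B + C) ≤ |c| * |s| * (2 * W) := by
    refine (le_abs_self _).trans ?_
    rw [abs_mul, abs_mul]
    exact mul_le_mul_of_nonneg_left (abs_le.2 ⟨by linarith, by linarith⟩) (by positivity)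
  have h2 : s ^ 2 * (D - A) ≤ s ^ 2 * (2 * W) :=
    mul_le_mul_of_nonneg_left (by linarith) (by positivity)
  have h3 : 4 * W * (|s| * (|c| + |s|)) ≤ γ * s ^ 2 + 4 * W ^ 2 / γ * (|c| + |s|) ^ 2 := by
    have : γ * s ^ 2 + 4 * W ^ 2 / γ * (|c| + |s|) ^ 2 - 4 * W * (|s| * (|c| + |s|)) =
        (γ * |s| - 2 * W * (|c| + |s|)) ^ 2 / γ := by
      rw [← sq_abs s]
      field_simp
      ring
    have h4 : 0 ≤ (γ * |s| - 2 * W * (|c| + |s|)) ^ 2 / γ := by positivity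
    linarith
  have h5 : (|c| + |s|) ^ 2 ≤ 2 * (c ^ 2 + s ^ 2) := by
    rw [← sq_abs c, ← sq_abs s]
    linarith [sq_nonneg (|c| - |s|)]
  have h6 : 4 * W ^ 2 / γ * (|c| + |s|) ^ 2 ≤ 4 * W ^ 2 / γ * (2 * (c ^ 2 + s ^ 2)) :=
    mul_le_mul_of_nonneg_left h5 (by positivity)
  have h7 : 0 ≤ 8 * W ^ 2 / γ * (c ^ 2 + s ^ 2) := by positivity
  have h8 : 16 * W ^ 2 / γ * (c ^ 2 + s ^ 2) = 4 * W ^ 2 / γ * (2 * (c ^ 2 + s ^ 2)) +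
      8 * W ^ 2 / γ * (c ^ 2 + s ^ 2) := by ring
  have h9 : 2 * (|c| * |s| * (2 * W)) + 2 * (s ^ 2 * (2 * W)) = 4 * W * (|s| * (|c| + |s|)) := by
    rw [← sq_abs s]
    ring
  linarith

/-- Second order upper bound for the operator norm near a map with a gap between its singular
values: to first order, only the image of the principal direction matters. -/
theorem IsPrincipalDirection.norm_add_sq_le (h : IsPrincipalDirection L a)
    (T : EuclideanSpace ℝ (Fin 2) →L[ℝ] EuclideanSpace ℝ (Fin m)) {γ M : ℝ} (hγ : 0 < γ)
    (hgap : ‖L (rot a)‖ ^ 2 + γ ≤ ‖L a‖ ^ 2) (hM : ‖L‖ ≤ M) :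
    ‖L + T‖ ^ 2 ≤ ‖L a‖ ^ 2 + 2 * inner ℝ (L a) (T a) + (16 * M ^ 2 / γ + 1) * ‖T‖ ^ 2 := by
  set N := ‖L a‖ ^ 2 + 2 * inner ℝ (L a) (T a) + (16 * M ^ 2 / γ + 1) * ‖T‖ ^ 2 with hN
  have hM0 : 0 ≤ M := (norm_nonneg _).trans hM
  have hra : ‖rot a‖ = 1 := by rw [norm_rot, h.norm_eq_one]
  have hb : ∀ x y : EuclideanSpace ℝ (Fin 2), ‖x‖ = 1 → ‖y‖ = 1 →
      |inner ℝ (L x) (T y)| ≤ M * ‖T‖ := by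
    intro x y hx hy
    have h1 := L.le_opNorm x
    have h2 := T.le_opNorm y
    rw [hx, mul_one] at h1
    rw [hy, mul_one] at h2
    exact (abs_real_inner_le_norm _ _).trans
      (mul_le_mul (h1.trans hM) h2 (norm_nonneg _) hM0)
  have key : ∀ v, ‖(L + T) v‖ ^ 2 ≤ N * ‖v‖ ^ 2 := by
    intro v
    set c := inner ℝ a v
    set s := inner ℝ (rot a) v
    have hv : v = c • a + s • rot a := eq_inner_smul_add_inner_rot_smul h.norm_eq_one v
    have hv2 : ‖v‖ ^ 2 = c ^ 2 + s ^ 2 := norm_sq_eq_inner_sq_add_inner_rot_sq h.norm_eq_one v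
    have hT : ‖T v‖ ^ 2 ≤ ‖T‖ ^ 2 * ‖v‖ ^ 2 := by
      rw [← mul_pow]
      exact pow_le_pow_left₀ (norm_nonneg _) (T.le_opNorm v) 2
    have hL2 : ‖L v‖ ^ 2 = c ^ 2 * ‖L a‖ ^ 2 + s ^ 2 * ‖L (rot a)‖ ^ 2 := by
      rw [hv, map_add, map_smul, map_smul, norm_add_sq_real, norm_smul, norm_smul,
        real_inner_smul_left, real_inner_smul_right, h.inner_eq_zero, mul_pow, mul_pow,
        Real.norm_eq_abs, Real.norm_eq_abs, sq_abs, sq_abs]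
      ring
    have hLT : inner ℝ (L v) (T v) = c ^ 2 * inner ℝ (L a) (T a)
        + c * s * (inner ℝ (L a) (T (rot a)) + inner ℝ (L (rot a)) (T a))
        + s ^ 2 * inner ℝ (L (rot a)) (T (rot a)) := by
      rw [hv]
      simp only [map_add, map_smul, inner_add_left, inner_add_right, real_inner_smul_left,
        real_inner_smul_right]
      ring
    have hA := (hb a a h.norm_eq_one h.norm_eq_one)
    have hB := (hb a (rot a) h.norm_eq_one hra)
    have hC := (hb (rot a) a hra h.norm_eq_one)
    have hD := (hb (rot a) (rot a) hra hra)
    set A := inner ℝ (L a) (T a)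
    set B := inner ℝ (L a) (T (rot a))
    set C := inner ℝ (L (rot a)) (T a)
    set D := inner ℝ (L (rot a)) (T (rot a))
    set W := M * ‖T‖ with hW
    have hsq : 16 * M ^ 2 / γ * ‖T‖ ^ 2 = 16 * W ^ 2 / γ := by rw [hW]; ring
    have hcross : 2 * (-s ^ 2 * A + c * s * (B + C) + s ^ 2 * D) ≤
        γ * s ^ 2 + 16 * W ^ 2 / γ * (c ^ 2 + s ^ 2) := mixed_terms_le hγ hA hB hC hD
    have hgap' : s ^ 2 * (‖L (rot a)‖ ^ 2 + γ) ≤ s ^ 2 * ‖L a‖ ^ 2 :=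
      mul_le_mul_of_nonneg_left hgap (by positivity)
    rw [add_apply, norm_add_sq_real, hL2, hLT, hN]
    rw [hv2] at hT ⊢
    have hexp : (‖L a‖ ^ 2 + 2 * A + (16 * M ^ 2 / γ + 1) * ‖T‖ ^ 2) * (c ^ 2 + s ^ 2) =
        (‖L a‖ ^ 2 + 2 * A) * (c ^ 2 + s ^ 2) + 16 * W ^ 2 / γ * (c ^ 2 + s ^ 2)
          + ‖T‖ ^ 2 * (c ^ 2 + s ^ 2) := by
      rw [← hsq]
      ring
    rw [hexp]
    linarith
  have hN0 : 0 ≤ N := by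
    have := (sq_nonneg _).trans (key a)
    rwa [h.norm_eq_one, one_pow, mul_one] at this
  have : ‖L + T‖ ≤ √N := by
    refine ContinuousLinearMap.opNorm_le_bound _ (Real.sqrt_nonneg _) fun v => ?_
    rw [← sq_le_sq₀ (norm_nonneg _) (by positivity), mul_pow, Real.sq_sqrt hN0]
    exact key v
  calc ‖L + T‖ ^ 2 ≤ √N ^ 2 := pow_le_pow_left₀ (norm_nonneg _) this 2
    _ = N := Real.sq_sqrt hN0

theorem IsPrincipalDirection.opNorm_eq (h : IsPrincipalDirection L a) : ‖L‖ = ‖L a‖ := by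
  have hgap : 0 < ‖L a‖ ^ 2 - ‖L (rot a)‖ ^ 2 :=
    sub_pos.2 (pow_lt_pow_left₀ h.norm_lt (norm_nonneg _) two_ne_zero)
  have h1 := h.norm_add_sq_le 0 hgap (by linarith) le_rfl
  simp only [add_zero, zero_apply, inner_zero_right, mul_zero, norm_zero,
    ne_eq, OfNat.ofNat_ne_zero, not_false_eq_true, zero_pow] at h1
  have h2 := L.le_opNorm a
  rw [h.norm_eq_one, mul_one] at h2
  exact le_antisymm ((sq_le_sq₀ (norm_nonneg _) (norm_nonneg _)).1 h1) h2

theorem IsPrincipalDirection.apply_ne_zero (h : IsPrincipalDirection L a) : L a ≠ 0 :=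
  norm_pos_iff.1 ((norm_nonneg _).trans_lt h.norm_lt)

theorem IsPrincipalDirectionField.isPrincipalDirection
    {U : Set (EuclideanSpace ℝ (Fin 2))}
    {u : EuclideanSpace ℝ (Fin 2) → EuclideanSpace ℝ (Fin m)}
    {a : EuclideanSpace ℝ (Fin 2) → EuclideanSpace ℝ (Fin 2)}
    (ha : IsPrincipalDirectionField U u a) {x : EuclideanSpace ℝ (Fin 2)} (hx : x ∈ U) :
    IsPrincipalDirection (fderiv ℝ u x) (a x) := by
  obtain ⟨μ, hμ, hspan⟩ := ha.spans x hx
  have h1 := ha.norm_eq_one x hx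
  set b := a x
  set L := fderiv ℝ u x with hL
  have hgram : ∀ v w, inner ℝ (gram u x v) w = inner ℝ (L v) (L w) := fun v w => by
    simp [gram, hL, ContinuousLinearMap.adjoint_inner_left]
  have hb : gram u x b = μ • b := by
    have : b ∈ (gram u x).eigenspace μ := hspan ▸ Submodule.mem_span_singleton_self b
    exact Module.End.mem_eigenspace_iff.1 this
  have horth : inner ℝ (L b) (L (rot b)) = 0 := by
    rw [← hgram, hb, real_inner_smul_left, inner_rot_self, mul_zero]
  have hrb : ‖rot b‖ = 1 := by rw [norm_rot, h1]
  -- the orthogonal direction is an eigenvector as well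
  have hrot : gram u x (rot b) = ‖L (rot b)‖ ^ 2 • rot b := by
    have h2 := eq_inner_smul_add_inner_rot_smul h1 (gram u x (rot b))
    rw [real_inner_comm, hgram, real_inner_comm, horth, zero_smul, zero_add, real_inner_comm,
      hgram, real_inner_self_eq_norm_sq] at h2
    exact h2
  have hrot0 : rot b ≠ 0 := by
    intro h
    rw [h, norm_zero] at hrb
    exact zero_ne_one hrb
  have hμ' : μ = ‖L b‖ ^ 2 := by
    rw [← real_inner_self_eq_norm_sq, ← hgram, hb, real_inner_smul_left,
      real_inner_self_eq_norm_sq, h1, one_pow, mul_one]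
  have hle : ‖L (rot b)‖ ^ 2 ≤ μ := hμ.2
    (Module.End.hasEigenvalue_of_hasEigenvector
      (Module.End.hasEigenvector_iff.2 ⟨Module.End.mem_eigenspace_iff.2 hrot, hrot0⟩))
  have hne : ‖L (rot b)‖ ^ 2 ≠ μ := by
    intro h
    rw [h] at hrot
    have hmem : rot b ∈ Submodule.span ℝ {b} := hspan ▸ Module.End.mem_eigenspace_iff.2 hrot
    obtain ⟨c, hc⟩ := Submodule.mem_span_singleton.1 hmem
    have h3 := inner_rot_self b
    rw [← hc, real_inner_smul_right, real_inner_self_eq_norm_sq, h1, one_pow, mul_one] at h3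
    rw [h3, zero_smul] at hc
    exact hrot0 hc.symm
  refine ⟨h1, horth, ?_⟩
  rw [← sq_lt_sq₀ (norm_nonneg _) (norm_nonneg _), ← hμ']
  exact lt_of_le_of_ne hle hne

end Fan

/-! ### Perturbations by squared positive parts -/

theorem hasDerivAt_max_zero_sq (t : ℝ) :
    HasDerivAt (fun t : ℝ => max t 0 ^ 2) (2 * max t 0) t := by
  rcases lt_trichotomy t 0 with ht | rfl | ht
  · have h : (fun t : ℝ => max t 0 ^ 2) =ᶠ[𝓝 t] fun _ => 0 := by
      filter_upwards [eventually_lt_nhds ht] with s hs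
      simp [max_eq_right hs.le]
    rw [max_eq_right ht.le, mul_zero]
    exact (hasDerivAt_const t (0 : ℝ)).congr_of_eventuallyEq h
  · rw [max_self, mul_zero, hasDerivAt_iff_isLittleO]
    have h : (fun t : ℝ => max t 0 ^ 2 - max (0 : ℝ) 0 ^ 2 - (t - 0) • (0 : ℝ)) =O[𝓝 0]
        fun t : ℝ => t ^ 2 := by
      refine Asymptotics.IsBigO.of_bound 1 (Filter.Eventually.of_forall fun t => ?_)
      simp only [max_self, ne_eq, OfNat.ofNat_ne_zero, not_false_eq_true, zero_pow, sub_zero,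
        smul_zero, norm_pow, Real.norm_eq_abs, one_mul]
      refine pow_le_pow_left₀ (abs_nonneg _) ?_ 2
      rw [abs_of_nonneg (le_max_right _ _)]
      exact max_le (le_abs_self t) (abs_nonneg t)
    refine h.trans_isLittleO ?_
    simpa using Asymptotics.isLittleO_pow_id (𝕜 := ℝ) one_lt_two
  · have h : (fun t : ℝ => max t 0 ^ 2) =ᶠ[𝓝 t] fun s => s ^ 2 := by
      filter_upwards [eventually_gt_nhds ht] with s hs
      rw [max_eq_left hs.le]
    rw [max_eq_left ht.le]
    simpa using (hasDerivAt_pow 2 t).congr_of_eventuallyEq h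

theorem contDiff_max_zero_sq : ContDiff ℝ 1 (fun t : ℝ => max t 0 ^ 2) := by
  rw [contDiff_one_iff_deriv]
  refine ⟨fun t => (hasDerivAt_max_zero_sq t).differentiableAt, ?_⟩
  have : deriv (fun t : ℝ => max t 0 ^ 2) = fun t => 2 * max t 0 :=
    funext fun t => (hasDerivAt_max_zero_sq t).deriv
  rw [this]
  fun_prop

section Bump

variable {E V : Type*} [NormedAddCommGroup E] [NormedAddCommGroup V] [NormedSpace ℝ V]
  {x₀ x : E} {r R : ℝ} {F : E → ℝ} {e : E → V}

/-- The vector field `F₊² e` on the ball of radius `R` about `x₀`, extended by zero. Its derivative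
is bounded by a multiple of `F₊`, which is what makes the quadratic error terms of a perturbation
in this direction negligible up to the boundary of the support. -/
noncomputable def bumpField (x₀ : E) (R : ℝ) (F : E → ℝ) (e : E → V) : E → V :=
  (Metric.ball x₀ R).indicator fun x => max (F x) 0 ^ 2 • e x

theorem bumpField_eq_zero (hneg : ∀ x ∈ Metric.ball x₀ R, r ≤ dist x x₀ → F x ≤ 0)
    (hx : r ≤ dist x x₀) : bumpField x₀ R F e x = 0 := by
  by_cases h : x ∈ Metric.ball x₀ R
  · simp [bumpField, h, max_eq_right (hneg x h hx)]
  · simp [bumpField, h]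

theorem tsupport_bumpField_subset (hneg : ∀ x ∈ Metric.ball x₀ R, r ≤ dist x x₀ → F x ≤ 0) :
    tsupport (bumpField x₀ R F e) ⊆ Metric.closedBall x₀ r := by
  refine closure_minimal (fun x hx => ?_) Metric.isClosed_closedBall
  by_contra h
  exact hx (bumpField_eq_zero hneg (not_le.1 h).le)

theorem bumpField_eventuallyEq (hx : x ∈ Metric.ball x₀ R) :
    bumpField x₀ R F e =ᶠ[𝓝 x] fun x => max (F x) 0 ^ 2 • e x := by
  filter_upwards [Metric.isOpen_ball.mem_nhds hx] with y hy
  simp [bumpField, hy]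

variable [NormedSpace ℝ E]

theorem contDiff_bumpField (hrR : r < R)
    (hneg : ∀ x ∈ Metric.ball x₀ R, r ≤ dist x x₀ → F x ≤ 0)
    (hF : ContDiffOn ℝ 1 F (Metric.ball x₀ R)) (he : ContDiffOn ℝ 1 e (Metric.ball x₀ R)) :
    ContDiff ℝ 1 (bumpField x₀ R F e) := by
  rw [contDiff_iff_contDiffAt]
  intro x
  by_cases hx : x ∈ Metric.ball x₀ R
  · have h := Metric.isOpen_ball.mem_nhds hx
    exact ((contDiff_max_zero_sq.contDiffAt.comp x (hF.contDiffAt h)).smul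
      (he.contDiffAt h)).congr_of_eventuallyEq (bumpField_eventuallyEq hx)
  · have hxr : x ∉ tsupport (bumpField x₀ R F e) := fun h =>
      hx (Metric.closedBall_subset_ball hrR (tsupport_bumpField_subset hneg h))
    exact contDiffAt_const.congr_of_eventuallyEq (notMem_tsupport_iff_eventuallyEq.1 hxr)

theorem fderiv_bumpField (hx : x ∈ Metric.ball x₀ R) (hF : DifferentiableAt ℝ F x)
    (he : DifferentiableAt ℝ e x) :
    fderiv ℝ (bumpField x₀ R F e) x = max (F x) 0 ^ 2 • fderiv ℝ e x +
      ((2 * max (F x) 0) • fderiv ℝ F x).smulRight (e x) := by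
  rw [(bumpField_eventuallyEq hx).fderiv_eq]
  exact (((hasDerivAt_max_zero_sq (F x)).comp_hasFDerivAt x hF.hasFDerivAt).fun_smul
    he.hasFDerivAt).fderiv

end Bump

namespace Fan

variable {m : ℕ} {U : Set (EuclideanSpace ℝ (Fin 2))}
  {u : EuclideanSpace ℝ (Fin 2) → EuclideanSpace ℝ (Fin m)}
  {a : EuclideanSpace ℝ (Fin 2) → EuclideanSpace ℝ (Fin 2)}

/-- The second order bound `IsPrincipalDirection.norm_add_sq_le` with a constant that is uniform
on a compact set. -/
theorem exists_norm_add_sq_le {S : Set (EuclideanSpace ℝ (Fin 2))} (hS : IsCompact S)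
    (hDu : ContinuousOn (fderiv ℝ u) S) (ha : ContinuousOn a S)
    (hp : ∀ x ∈ S, IsPrincipalDirection (fderiv ℝ u x) (a x)) :
    ∃ C, 0 ≤ C ∧ ∀ x ∈ S, ∀ T : EuclideanSpace ℝ (Fin 2) →L[ℝ] EuclideanSpace ℝ (Fin m),
      ‖fderiv ℝ u x + T‖ ^ 2 ≤
        ‖fderiv ℝ u x‖ ^ 2 + 2 * inner ℝ (fderiv ℝ u x (a x)) (T (a x)) + C * ‖T‖ ^ 2 := by
  rcases S.eq_empty_or_nonempty with rfl | hne
  · exact ⟨0, le_rfl, by simp⟩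
  obtain ⟨M, hM⟩ := hS.exists_bound_of_continuousOn hDu
  have hgap : ContinuousOn
      (fun x => ‖fderiv ℝ u x (a x)‖ ^ 2 - ‖fderiv ℝ u x (rot (a x))‖ ^ 2) S :=
    ((hDu.clm_apply ha).norm.pow 2).sub
      ((hDu.clm_apply (rot.continuous.comp_continuousOn ha)).norm.pow 2)
  obtain ⟨z, hz, hmin⟩ := hS.exists_isMinOn hne hgap
  set γ := ‖fderiv ℝ u z (a z)‖ ^ 2 - ‖fderiv ℝ u z (rot (a z))‖ ^ 2 with hγdef
  have hγ : 0 < γ := sub_pos.2 (pow_lt_pow_left₀ (hp z hz).norm_lt (norm_nonneg _) two_ne_zero)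
  refine ⟨16 * M ^ 2 / γ + 1, by positivity, fun x hx T => ?_⟩
  have h1 : γ ≤ ‖fderiv ℝ u x (a x)‖ ^ 2 - ‖fderiv ℝ u x (rot (a x))‖ ^ 2 := hmin hx
  have := (hp x hx).norm_add_sq_le T hγ (by linarith) (hM x hx)
  rwa [← (hp x hx).opNorm_eq] at this

/-- The perturbation argument. With `p = Du a`, the function
`2 (DF a) ⟪p, e⟫ + F ⟪p, De a⟫` is, up to the factor `2 ε F₊`, the first order change of `‖Du‖²`
under the perturbation `ε F₊² e`. If, where `F > 0`, it is at most `-η F` or `‖Du‖` is at most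
`s < ‖Du x₀‖`, the perturbation shows that `u` is not tight. -/
theorem not_isTight_of_bumpField (hU : IsOpen U) (hu : ContDiffOn ℝ 1 u U)
    (ha : ContinuousOn a U) (hp : ∀ x ∈ U, IsPrincipalDirection (fderiv ℝ u x) (a x))
    {x₀ : EuclideanSpace ℝ (Fin 2)} {r R : ℝ} (hr : 0 < r) (hrR : r < R)
    (hball : Metric.closedBall x₀ R ⊆ U) {F : EuclideanSpace ℝ (Fin 2) → ℝ}
    {e : EuclideanSpace ℝ (Fin 2) → EuclideanSpace ℝ (Fin m)} (hF : ContDiffOn ℝ 1 F U)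
    (he : ContDiffOn ℝ 1 e U) (hneg : ∀ x ∈ Metric.ball x₀ R, r ≤ dist x x₀ → F x ≤ 0)
    {η s : ℝ} (hη : 0 < η) (hs : s < ‖fderiv ℝ u x₀‖) (hF0 : 0 < F x₀)
    (hG0 : 2 * fderiv ℝ F x₀ (a x₀) * inner ℝ (fderiv ℝ u x₀ (a x₀)) (e x₀) +
      F x₀ * inner ℝ (fderiv ℝ u x₀ (a x₀)) (fderiv ℝ e x₀ (a x₀)) ≤ -η * F x₀)
    (hG : ∀ x ∈ Metric.ball x₀ R, 0 < F x →
      2 * fderiv ℝ F x (a x) * inner ℝ (fderiv ℝ u x (a x)) (e x) +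
        F x * inner ℝ (fderiv ℝ u x (a x)) (fderiv ℝ e x (a x)) ≤ -η * F x ∨
      ‖fderiv ℝ u x‖ ≤ s) : ¬ IsTight U u := by
  have hdF := hF.continuousOn_fderiv_of_isOpen hU le_rfl
  have hde := he.continuousOn_fderiv_of_isOpen hU le_rfl
  have hdu := hu.continuousOn_fderiv_of_isOpen hU le_rfl
  have hcomp := isCompact_closedBall x₀ R
  have hsub : Metric.ball x₀ R ⊆ U := Metric.ball_subset_closedBall.trans hball
  have hx₀ : x₀ ∈ Metric.ball x₀ R := Metric.mem_ball_self (hr.trans hrR)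
  obtain ⟨C, hC0, hC⟩ := exists_norm_add_sq_le hcomp (hdu.mono hball) (ha.mono hball)
    (fun x hx => hp x (hball hx))
  obtain ⟨M₁, hM₁⟩ := hcomp.exists_bound_of_continuousOn (hF.continuousOn.mono hball)
  obtain ⟨M₂, hM₂⟩ := hcomp.exists_bound_of_continuousOn (he.continuousOn.mono hball)
  obtain ⟨M₃, hM₃⟩ := hcomp.exists_bound_of_continuousOn (hdF.mono hball)
  obtain ⟨M₄, hM₄⟩ := hcomp.exists_bound_of_continuousOn (hde.mono hball)
  have h0 : x₀ ∈ Metric.closedBall x₀ R := Metric.ball_subset_closedBall hx₀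
  have hM₁0 := (norm_nonneg _).trans (hM₁ x₀ h0)
  have hM₂0 := (norm_nonneg _).trans (hM₂ x₀ h0)
  have hM₃0 := (norm_nonneg _).trans (hM₃ x₀ h0)
  have hM₄0 := (norm_nonneg _).trans (hM₄ x₀ h0)
  set K := M₁ * M₄ + 2 * M₃ * M₂ with hK
  have hK0 : 0 ≤ K := by positivity
  set w := bumpField x₀ R F e with hw
  have hwC : ContDiff ℝ 1 w := contDiff_bumpField hrR hneg (hF.mono hsub) (he.mono hsub)
  have hwsupp : tsupport w ⊆ Metric.closedBall x₀ r := tsupport_bumpField_subset hneg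
  have hdw : ∀ x ∈ Metric.ball x₀ R, fderiv ℝ w x = max (F x) 0 ^ 2 • fderiv ℝ e x +
      ((2 * max (F x) 0) • fderiv ℝ F x).smulRight (e x) := fun x hx =>
    fderiv_bumpField hx ((hF.contDiffAt (hU.mem_nhds (hsub hx))).differentiableAt (by simp))
      ((he.contDiffAt (hU.mem_nhds (hsub hx))).differentiableAt (by simp))
  have hdw_norm : ∀ x ∈ Metric.ball x₀ R, 0 < F x → ‖fderiv ℝ w x‖ ≤ K * F x := by
    intro x hx hFx
    have hx' := Metric.ball_subset_closedBall hx
    have h1 := hM₁ x hx'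
    rw [Real.norm_eq_abs, abs_of_pos hFx] at h1
    rw [hdw x hx, max_eq_left hFx.le]
    refine (norm_add_le _ _).trans ?_
    rw [norm_smul, ContinuousLinearMap.norm_smulRight_apply, norm_smul, norm_pow, norm_mul,
      Real.norm_eq_abs (F x), abs_of_pos hFx, Real.norm_ofNat]
    have h4 : F x ^ 2 * ‖fderiv ℝ e x‖ ≤ F x * M₁ * M₄ := by
      rw [sq]
      exact mul_le_mul (mul_le_mul_of_nonneg_left h1 hFx.le) (hM₄ x hx') (norm_nonneg _)
        (by positivity)
    have h5 : 2 * F x * ‖fderiv ℝ F x‖ * ‖e x‖ ≤ 2 * F x * M₃ * M₂ :=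
      mul_le_mul (mul_le_mul_of_nonneg_left (hM₃ x hx') (by positivity)) (hM₂ x hx')
        (norm_nonneg _) (by positivity)
    rw [hK]
    linarith
  have hinner : ∀ x ∈ Metric.ball x₀ R, 0 < F x →
      inner ℝ (fderiv ℝ u x (a x)) (fderiv ℝ w x (a x)) =
      F x * (2 * fderiv ℝ F x (a x) * inner ℝ (fderiv ℝ u x (a x)) (e x) +
        F x * inner ℝ (fderiv ℝ u x (a x)) (fderiv ℝ e x (a x))) := by
    intro x hx hFx
    rw [hdw x hx, max_eq_left hFx.le]
    simp only [add_apply, smul_apply, ContinuousLinearMap.smulRight_apply, inner_add_right,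
      real_inner_smul_right, smul_eq_mul]
    ring
  -- the size of the perturbation
  obtain ⟨ε, hε, hε1, hε2⟩ : ∃ ε : ℝ, 0 < ε ∧ C * K ^ 2 * ε < 2 * η ∧
      K * M₁ * ε ≤ (‖fderiv ℝ u x₀‖ - s) / 2 := by
    have hs' : 0 < (‖fderiv ℝ u x₀‖ - s) / 2 := by linarith
    have hc : ∀ A B : ℝ, 0 ≤ A → 0 < B → ∀ᶠ ε in 𝓝[>] (0 : ℝ), A * ε < B := by
      intro A B _ hB
      have : Filter.Tendsto (fun ε : ℝ => A * ε) (𝓝 0) (𝓝 (A * 0)) :=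
        (continuous_const.mul continuous_id).tendsto 0
      rw [mul_zero] at this
      exact (this.eventually_lt_const hB).filter_mono nhdsWithin_le_nhds
    obtain ⟨ε, ⟨h1, h2⟩, h3⟩ := (((hc (C * K ^ 2) (2 * η) (by positivity) (by positivity)).and
      (hc (K * M₁) _ (by positivity) hs')).and self_mem_nhdsWithin).exists
    exact ⟨ε, h3, h1, h2.le⟩
  have hdv : ∀ x ∈ U, fderiv ℝ (fun y => u y + ε • w y) x =
      fderiv ℝ u x + ε • fderiv ℝ w x := by
    intro x hx
    have h1 : DifferentiableAt ℝ u x :=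
      (hu.contDiffAt (hU.mem_nhds hx)).differentiableAt (by simp)
    have h2 : DifferentiableAt ℝ w x := hwC.contDiffAt.differentiableAt (by simp)
    exact (h1.hasFDerivAt.add (h2.hasFDerivAt.const_smul ε)).fderiv
  have hdec : ∀ x ∈ Metric.ball x₀ R, 0 < F x →
      2 * fderiv ℝ F x (a x) * inner ℝ (fderiv ℝ u x (a x)) (e x) +
        F x * inner ℝ (fderiv ℝ u x (a x)) (fderiv ℝ e x (a x)) ≤ -η * F x →
      ‖fderiv ℝ (fun y => u y + ε • w y) x‖ < ‖fderiv ℝ u x‖ := by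
    intro x hx hFx hGx
    rw [hdv x (hsub hx), ← sq_lt_sq₀ (norm_nonneg _) (norm_nonneg _)]
    refine (hC x (Metric.ball_subset_closedBall hx) _).trans_lt ?_
    rw [smul_apply, real_inner_smul_right, hinner x hx hFx, norm_smul, Real.norm_eq_abs,
      abs_of_pos hε, mul_pow]
    have h1 : ‖fderiv ℝ w x‖ ^ 2 ≤ (K * F x) ^ 2 :=
      pow_le_pow_left₀ (norm_nonneg _) (hdw_norm x hx hFx) 2
    have h2 : C * (ε ^ 2 * ‖fderiv ℝ w x‖ ^ 2) ≤ C * (ε ^ 2 * (K * F x) ^ 2) := by gcongr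
    have h3 : F x * (2 * fderiv ℝ F x (a x) * inner ℝ (fderiv ℝ u x (a x)) (e x) +
        F x * inner ℝ (fderiv ℝ u x (a x)) (fderiv ℝ e x (a x))) ≤ F x * (-η * F x) :=
      mul_le_mul_of_nonneg_left hGx hFx.le
    have h4 : 2 * (ε * (F x * (2 * fderiv ℝ F x (a x) * inner ℝ (fderiv ℝ u x (a x)) (e x) +
        F x * inner ℝ (fderiv ℝ u x (a x)) (fderiv ℝ e x (a x))))) ≤
        2 * (ε * (F x * (-η * F x))) := by gcongr
    have h5 : C * (ε ^ 2 * (K * F x) ^ 2) < 2 * (ε * (F x * (η * F x))) := by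
      calc C * (ε ^ 2 * (K * F x) ^ 2) = (C * K ^ 2 * ε) * (ε * F x ^ 2) := by ring
        _ < 2 * η * (ε * F x ^ 2) := mul_lt_mul_of_pos_right hε1 (by positivity)
        _ = _ := by ring
    linarith
  have hsame : ∀ x ∈ U, ¬ (x ∈ Metric.ball x₀ R ∧ 0 < F x) → fderiv ℝ w x = 0 := by
    intro x hx h
    by_cases hxb : x ∈ Metric.ball x₀ R
    · have hFx : F x ≤ 0 := not_lt.1 fun h' => h ⟨hxb, h'⟩
      rw [hdw x hxb, max_eq_right hFx]
      ext
      simp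
    · have hxr : x ∉ tsupport w := fun h' =>
        hxb (Metric.closedBall_subset_ball hrR (hwsupp h'))
      rw [(notMem_tsupport_iff_eventuallyEq.1 hxr).fderiv_eq]
      simp
  have hsupp' : tsupport (fun y => ε • w y) ⊆ Metric.closedBall x₀ r :=
    (tsupport_smul_subset_right (fun _ => ε) w).trans hwsupp
  refine not_isTight_of_perturbation (w := fun y => ε • w y) (x := x₀)
    (t := (s + ‖fderiv ℝ u x₀‖) / 2) hU hu (hwC.const_smul ε)
    (HasCompactSupport.of_support_subset_isCompact (isCompact_closedBall x₀ r)
      ((subset_tsupport _).trans hsupp'))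
    (hsupp'.trans ((Metric.closedBall_subset_closedBall hrR.le).trans hball)) (hsub hx₀)
    (by linarith) (hdec x₀ hx₀ hF0 hG0) fun x hx hlt => ?_
  by_cases hxF : x ∈ Metric.ball x₀ R ∧ 0 < F x
  · rcases hG x hxF.1 hxF.2 with h | h
    · exact absurd (hdec x hxF.1 hxF.2 h) hlt.not_gt
    · rw [hdv x hx]
      refine (norm_add_le _ _).trans ?_
      rw [norm_smul, Real.norm_eq_abs, abs_of_pos hε]
      have h1 := hM₁ x (Metric.ball_subset_closedBall hxF.1)
      rw [Real.norm_eq_abs, abs_of_pos hxF.2] at h1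
      have h2 : ε * ‖fderiv ℝ w x‖ ≤ ε * (K * M₁) := by
        gcongr
        exact (hdw_norm x hxF.1 hxF.2).trans (by gcongr)
      linarith
  · have h0 : fderiv ℝ u x + ε • fderiv ℝ w x = fderiv ℝ u x := by
      rw [hsame x hx hxF]
      ext
      simp
    rw [hdv x hx, h0] at hlt
    exact absurd hlt (lt_irrefl _)

end Fan

/-! ### The Euler-Lagrange equation of tight functions -/

namespace Fan

variable {m : ℕ} {U : Set (EuclideanSpace ℝ (Fin 2))}
  {u : EuclideanSpace ℝ (Fin 2) → EuclideanSpace ℝ (Fin m)}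
  {a : EuclideanSpace ℝ (Fin 2) → EuclideanSpace ℝ (Fin 2)}

/-- The derivative of `u` in the direction `a`. -/
noncomputable def dirDeriv {V : Type*} [NormedAddCommGroup V] [NormedSpace ℝ V]
    (a : EuclideanSpace ℝ (Fin 2) → EuclideanSpace ℝ (Fin 2))
    (u : EuclideanSpace ℝ (Fin 2) → V) (x : EuclideanSpace ℝ (Fin 2)) : V :=
  fderiv ℝ u x (a x)

theorem contDiffOn_dirDeriv {V : Type*} [NormedAddCommGroup V] [NormedSpace ℝ V]
    {u : EuclideanSpace ℝ (Fin 2) → V} (hU : IsOpen U) (ha : ContDiffOn ℝ ∞ a U)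
    (hu : ContDiffOn ℝ ∞ u U) : ContDiffOn ℝ ∞ (dirDeriv a u) U :=
  (hu.fderiv_of_isOpen hU (by simp)).clm_apply ha

theorem _root_.ContDiffOn.differentiableAt_of_isOpen {E V : Type*} [NormedAddCommGroup E]
    [NormedSpace ℝ E] [NormedAddCommGroup V] [NormedSpace ℝ V] {f : E → V} {U : Set E}
    (hf : ContDiffOn ℝ ∞ f U) (hU : IsOpen U) {x : E} (hx : x ∈ U) : DifferentiableAt ℝ f x :=
  (hf.contDiffAt (hU.mem_nhds hx)).differentiableAt (by simp)

/-- Differentiating a constant inner product. -/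
theorem inner_fderiv_eq_neg_of_inner_eq_const {E V : Type*} [NormedAddCommGroup E]
    [NormedSpace ℝ E] [NormedAddCommGroup V] [InnerProductSpace ℝ V] {f g : E → V} {U : Set E}
    (hU : IsOpen U) {x : E} (hx : x ∈ U) (hf : DifferentiableAt ℝ f x)
    (hg : DifferentiableAt ℝ g x) {c : ℝ} (hc : ∀ y ∈ U, inner ℝ (f y) (g y) = c) (h : E) :
    inner ℝ (f x) (fderiv ℝ g x h) = -inner ℝ (fderiv ℝ f x h) (g x) := by
  have h1 := fderiv_inner_apply ℝ hf hg h
  have h2 : (fun y => inner ℝ (f y) (g y)) =ᶠ[𝓝 x] fun _ => c := by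
    filter_upwards [hU.mem_nhds hx] with y hy using hc y hy
  rw [h2.fderiv_eq, fderiv_fun_const] at h1
  simp only [Pi.zero_apply, zero_apply] at h1
  linarith

/-- The norm `‖Du‖` does not increase in the direction `a`. Otherwise a perturbation along
`Du a / |Du a|²`, supported where `|Du a|² + K |x - x₀|² ≤ |Du a (x₀)|² + δ`, would lower `‖Du‖` at
`x₀` and raise it only where it is bounded away from its value at `x₀`. -/
theorem inner_dirDeriv_nonpos (hU : IsOpen U) (hu : ContDiffOn ℝ ∞ u U)
    (ha : ContDiffOn ℝ ∞ a U) (hp : ∀ x ∈ U, IsPrincipalDirection (fderiv ℝ u x) (a x))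
    (htight : IsTight U u) {x₀ : EuclideanSpace ℝ (Fin 2)} (hx₀ : x₀ ∈ U) :
    inner ℝ (dirDeriv a u x₀) (dirDeriv a (dirDeriv a u) x₀) ≤ 0 := by
  by_contra! hg
  set p := dirDeriv a u with hpdef
  set q := dirDeriv a p with hqdef
  set g := inner ℝ (p x₀) (q x₀) with hgdef
  have hpS : ContDiffOn ℝ ∞ p U := contDiffOn_dirDeriv hU ha hu
  have hqS : ContDiffOn ℝ ∞ q U := contDiffOn_dirDeriv hU ha hpS
  have hpne : ∀ x ∈ U, p x ≠ 0 := fun x hx => (hp x hx).apply_ne_zero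
  have hnorm : ∀ x ∈ U, ‖fderiv ℝ u x‖ = ‖p x‖ := fun x hx => (hp x hx).opNorm_eq
  -- a ball on which `‖Du‖` still increases in the direction `a`
  obtain ⟨R, hR, hball, hgR⟩ : ∃ R > 0, Metric.closedBall x₀ R ⊆ U ∧
      ∀ x ∈ Metric.closedBall x₀ R, g / 2 < inner ℝ (p x) (q x) := by
    have h1 : ∀ᶠ x in 𝓝 x₀, g / 2 < inner ℝ (p x) (q x) :=
      (((hpS.continuousOn.inner hqS.continuousOn).continuousAt
        (hU.mem_nhds hx₀))).eventually_const_lt (half_lt_self hg)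
    obtain ⟨R, hR, h⟩ := Metric.nhds_basis_closedBall.eventually_iff.1
      ((hU.eventually_mem hx₀).and h1)
    exact ⟨R, hR, fun x hx => (h hx).1, fun x hx => (h hx).2⟩
  set Q := ‖p x₀‖ ^ 2 with hQ
  have hQ0 : 0 < Q := pow_pos (norm_pos_iff.2 (hpne x₀ hx₀)) 2
  set K := 4 * (g ^ 2 + Q) / R ^ 2 + 1 with hK
  have hK1 : 1 ≤ K := by
    have : 0 ≤ 4 * (g ^ 2 + Q) / R ^ 2 := by positivity
    linarith
  have hK0 : 0 < K := by linarith
  have hKR : g ^ 2 + Q ≤ K * (R / 2) ^ 2 := by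
    have h1 : K * (R / 2) ^ 2 = g ^ 2 + Q + (R / 2) ^ 2 := by
      rw [hK]
      field_simp
      ring
    rw [h1]
    linarith [sq_nonneg (R / 2)]
  set δ := g ^ 2 / (32 * K) with hδ
  have hδ0 : 0 < δ := by positivity
  have hδg : δ ≤ g ^ 2 := by
    refine div_le_self (sq_nonneg _) ?_
    linarith
  set F : EuclideanSpace ℝ (Fin 2) → ℝ := fun x => δ - (‖p x‖ ^ 2 - Q) - K * ‖x - x₀‖ ^ 2 with hF
  have hFS : ContDiffOn ℝ ∞ F U :=
    (contDiffOn_const.sub ((hpS.norm_sq ℝ).sub contDiffOn_const)).sub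
      (contDiffOn_const.mul ((contDiffOn_id.sub contDiffOn_const).norm_sq ℝ))
  have hFle : ∀ x, F x ≤ δ + Q := fun x => by
    have h1 : 0 ≤ ‖p x‖ ^ 2 := by positivity
    have h2 : 0 ≤ K * ‖x - x₀‖ ^ 2 := by positivity
    simp only [hF]
    linarith
  have hdF : ∀ x ∈ U, fderiv ℝ F x (a x) =
      -2 * inner ℝ (p x) (q x) - 2 * K * inner ℝ (x - x₀) (a x) := by
    intro x hx
    have h1 : HasFDerivAt p (fderiv ℝ p x) x := (hpS.differentiableAt_of_isOpen hU hx).hasFDerivAt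
    have h2 : HasFDerivAt (fun y : EuclideanSpace ℝ (Fin 2) => y - x₀)
        (ContinuousLinearMap.id ℝ _) x := (hasFDerivAt_id x).sub_const x₀
    have h3 := (((h1.norm_sq.sub_const Q).const_sub δ).sub (h2.norm_sq.const_mul K)).fderiv
    have h4 : fderiv ℝ F x = _ := h3
    rw [h4]
    simp [hqdef, dirDeriv, inner_sub_left]
    ring
  set e : EuclideanSpace ℝ (Fin 2) → EuclideanSpace ℝ (Fin m) := fun x => (‖p x‖ ^ 2)⁻¹ • p x
    with he
  have heS : ContDiffOn ℝ ∞ e U := ((hpS.norm_sq ℝ).inv fun x hx =>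
    pow_ne_zero 2 (norm_ne_zero_iff.2 (hpne x hx))).smul hpS
  have hpe : ∀ x ∈ U, inner ℝ (p x) (e x) = 1 := fun x hx => by
    rw [he, real_inner_smul_right, real_inner_self_eq_norm_sq,
      inv_mul_cancel₀ (pow_ne_zero 2 (norm_ne_zero_iff.2 (hpne x hx)))]
  have hpde : ∀ x ∈ U, inner ℝ (p x) (fderiv ℝ e x (a x)) =
      -((‖p x‖ ^ 2)⁻¹ * inner ℝ (p x) (q x)) := fun x hx => by
    rw [inner_fderiv_eq_neg_of_inner_eq_const hU hx (hpS.differentiableAt_of_isOpen hU hx)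
      (heS.differentiableAt_of_isOpen hU hx) hpe, he, real_inner_smul_right, real_inner_comm]
    rfl
  have hFx₀ : F x₀ = δ := by simp [hF, hQ]
  -- close to `x₀` the perturbation is decreasing
  have hnear : ∀ x ∈ Metric.ball x₀ R, 0 < F x → ‖x - x₀‖ ≤ g / (4 * K) →
      2 * fderiv ℝ F x (a x) * inner ℝ (fderiv ℝ u x (a x)) (e x) +
        F x * inner ℝ (fderiv ℝ u x (a x)) (fderiv ℝ e x (a x)) ≤ -(g / (δ + Q)) * F x := by
    intro x hxb hFx hx
    have hxc := Metric.ball_subset_closedBall hxb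
    have hxU := hball hxc
    change 2 * fderiv ℝ F x (a x) * inner ℝ (p x) (e x) +
      F x * inner ℝ (p x) (fderiv ℝ e x (a x)) ≤ _
    rw [hpe x hxU, hpde x hxU, hdF x hxU]
    have h1 := hgR x hxc
    have h2 : -(g / (4 * K)) ≤ inner ℝ (x - x₀) (a x) := by
      have := abs_real_inner_le_norm (x - x₀) (a x)
      rw [(hp x hxU).norm_eq_one, mul_one] at this
      exact (abs_le.1 (this.trans hx)).1
    have h3 : 2 * K * (-(g / (4 * K))) ≤ 2 * K * inner ℝ (x - x₀) (a x) :=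
      mul_le_mul_of_nonneg_left h2 (by positivity)
    have h4 : 2 * K * (-(g / (4 * K))) = -(g / 2) := by
      field_simp
      ring
    have h5 : 0 ≤ F x * ((‖p x‖ ^ 2)⁻¹ * inner ℝ (p x) (q x)) :=
      mul_nonneg hFx.le (mul_nonneg (by positivity) (by linarith))
    have h6 : g / (δ + Q) * F x ≤ g := by
      rw [div_mul_eq_mul_div, div_le_iff₀ (by positivity)]
      exact mul_le_mul_of_nonneg_left (hFle x) hg.le
    linarith
  refine not_isTight_of_bumpField (x₀ := x₀) (r := R / 2) (R := R) (F := F) (e := e)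
    (η := g / (δ + Q)) (s := √(Q - δ)) hU (hu.of_le (by simp)) ha.continuousOn hp (half_pos hR)
    (half_lt_self hR) hball (hFS.of_le (by simp)) (heS.of_le (by simp)) ?_ (by positivity) ?_
    (hFx₀ ▸ hδ0) (hnear x₀ (Metric.mem_ball_self hR) (hFx₀ ▸ hδ0) ?_) ?_ htight
  · intro x _ hx
    rw [dist_eq_norm] at hx
    have h1 : K * (R / 2) ^ 2 ≤ K * ‖x - x₀‖ ^ 2 := by gcongr
    have h2 : 0 ≤ ‖p x‖ ^ 2 := by positivity
    simp only [hF]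
    linarith
  · rw [hnorm x₀ hx₀, Real.sqrt_lt' (norm_pos_iff.2 (hpne x₀ hx₀))]
    linarith
  · rw [sub_self, norm_zero]
    positivity
  · intro x hxb hFx
    by_cases hx : ‖x - x₀‖ ≤ g / (4 * K)
    · exact Or.inl (hnear x hxb hFx hx)
    · right
      -- far from `x₀`, positivity of `F` forces `|Du a|² ≤ |Du a (x₀)|² - δ`
      rw [hnorm x (hball (Metric.ball_subset_closedBall hxb))]
      apply Real.le_sqrt_of_sq_le
      have h1 : K * (g / (4 * K)) ^ 2 ≤ K * ‖x - x₀‖ ^ 2 := by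
        have := (not_le.1 hx).le
        gcongr
      have h2 : K * (g / (4 * K)) ^ 2 = 2 * δ := by
        rw [hδ]
        field_simp
        ring
      simp only [hF] at hFx
      linarith

/-- The Euler-Lagrange equation `D_a (Du a) = 0`. Both signs of `a` give that `|Du a|` is constant
in the direction `a`; then `q = D_a (Du a)` is orthogonal to `Du a`, and `⟪Du a, D_a q⟫ = -|q|²`, so
a perturbation in the direction `q` would lower `‖Du‖` on all of its support. -/
theorem dirDeriv_dirDeriv_eq_zero (hU : IsOpen U) (hu : ContDiffOn ℝ ∞ u U)
    (ha : ContDiffOn ℝ ∞ a U) (hp : ∀ x ∈ U, IsPrincipalDirection (fderiv ℝ u x) (a x))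
    (htight : IsTight U u) {x₀ : EuclideanSpace ℝ (Fin 2)} (hx₀ : x₀ ∈ U) :
    dirDeriv a (dirDeriv a u) x₀ = 0 := by
  set p := dirDeriv a u with hpdef
  set q := dirDeriv a p with hqdef
  have hpS : ContDiffOn ℝ ∞ p U := contDiffOn_dirDeriv hU ha hu
  have hqS : ContDiffOn ℝ ∞ q U := contDiffOn_dirDeriv hU ha hpS
  have hpq : ∀ x ∈ U, inner ℝ (p x) (q x) = 0 := by
    intro x hx
    refine le_antisymm (inner_dirDeriv_nonpos hU hu ha hp htight hx) ?_
    have h1 := inner_dirDeriv_nonpos (a := fun y => -a y) hU hu ha.neg (fun y hy => (hp y hy).neg)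
      htight hx
    have h2 : dirDeriv (fun y => -a y) u = fun y => -p y := by
      funext y
      simp [dirDeriv, hpdef]
    have h3 : dirDeriv (fun y => -a y) (fun y => -p y) x = q x := by
      simp [dirDeriv, hqdef, fderiv_fun_neg]
    rw [h2, h3, inner_neg_left] at h1
    linarith
  by_contra hne
  set κ := ‖q x₀‖ ^ 2 / 2 with hκ
  have hκ0 : 0 < κ := half_pos (pow_pos (norm_pos_iff.2 hne) 2)
  obtain ⟨R, hR, hball, hκR⟩ : ∃ R > 0, Metric.closedBall x₀ R ⊆ U ∧
      ∀ x ∈ Metric.closedBall x₀ R, κ < ‖q x‖ ^ 2 := by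
    have h1 : ∀ᶠ x in 𝓝 x₀, κ < ‖q x‖ ^ 2 :=
      ((hqS.continuousOn.norm.pow 2).continuousAt
        (hU.mem_nhds hx₀)).eventually_const_lt (half_lt_self (by simpa [hκ] using hκ0))
    obtain ⟨R, hR, h⟩ := Metric.nhds_basis_closedBall.eventually_iff.1
      ((hU.eventually_mem hx₀).and h1)
    exact ⟨R, hR, fun x hx => (h hx).1, fun x hx => (h hx).2⟩
  set F : EuclideanSpace ℝ (Fin 2) → ℝ := fun x => (R / 2) ^ 2 - ‖x - x₀‖ ^ 2 with hF
  have hFS : ContDiffOn ℝ ∞ F U :=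
    contDiffOn_const.sub ((contDiffOn_id.sub contDiffOn_const).norm_sq ℝ)
  have hpdq : ∀ x ∈ U, inner ℝ (p x) (fderiv ℝ q x (a x)) = -‖q x‖ ^ 2 := fun x hx => by
    rw [inner_fderiv_eq_neg_of_inner_eq_const hU hx (hpS.differentiableAt_of_isOpen hU hx)
      (hqS.differentiableAt_of_isOpen hU hx) hpq, ← real_inner_self_eq_norm_sq]
    rfl
  have hdec : ∀ x ∈ Metric.ball x₀ R, 0 < F x →
      2 * fderiv ℝ F x (a x) * inner ℝ (fderiv ℝ u x (a x)) (q x) +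
        F x * inner ℝ (fderiv ℝ u x (a x)) (fderiv ℝ q x (a x)) ≤ -κ * F x := by
    intro x hxb hFx
    have hxc := Metric.ball_subset_closedBall hxb
    change 2 * fderiv ℝ F x (a x) * inner ℝ (p x) (q x) +
      F x * inner ℝ (p x) (fderiv ℝ q x (a x)) ≤ _
    rw [hpq x (hball hxc), hpdq x (hball hxc)]
    have := mul_le_mul_of_nonneg_left (hκR x hxc).le hFx.le
    linarith
  have hF0 : 0 < F x₀ := by
    have : 0 < (R / 2) ^ 2 := by positivity
    simpa [hF] using this
  refine not_isTight_of_bumpField (x₀ := x₀) (r := R / 2) (R := R) (F := F) (e := q)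
    (η := κ) (s := ‖fderiv ℝ u x₀‖ - 1) hU (hu.of_le (by simp)) ha.continuousOn hp (half_pos hR)
    (half_lt_self hR) hball (hFS.of_le (by simp)) (hqS.of_le (by simp)) ?_ hκ0 (by linarith) hF0
    (hdec x₀ (Metric.mem_ball_self hR) hF0) (fun x hx hFx => Or.inl (hdec x hx hFx)) htight
  intro x _ hx
  rw [dist_eq_norm] at hx
  have : (R / 2) ^ 2 ≤ ‖x - x₀‖ ^ 2 := by gcongr
  simp only [hF]
  linarith

end Fan

/-! ### Smooth infinity harmonic functions -/

theorem deriv_deriv_nonneg_of_isLocalMin {g : ℝ → ℝ} {t : ℝ} (hg : ContinuousAt g t)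
    (hmin : IsLocalMin g t) : 0 ≤ deriv (deriv g) t := by
  by_contra! hneg
  -- otherwise `t` is a local maximum as well, and `g` is locally constant
  have hmax : IsLocalMax g t := isLocalMax_of_deriv_deriv_neg hneg hmin.deriv_eq_zero hg
  have hconst : g =ᶠ[𝓝 t] fun _ => g t := by
    filter_upwards [hmin, hmax] with s h1 h2 using le_antisymm h2 h1
  have h0 : deriv (deriv g) t = 0 := by
    rw [hconst.deriv.deriv_eq]
    simp
  exact hneg.ne h0

theorem fderiv_fderiv_nonneg_of_isLocalMin {E : Type*} [NormedAddCommGroup E] [NormedSpace ℝ E]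
    {ψ : E → ℝ} {x : E} (hψ : ContDiffAt ℝ 2 ψ x) (hmin : IsLocalMin ψ x) (h : E) :
    0 ≤ fderiv ℝ (fderiv ℝ ψ) x h h := by
  have hline : ∀ t : ℝ, HasDerivAt (fun t : ℝ => x + t • h) h t := fun t => by
    simpa using ((hasDerivAt_id t).smul_const h).const_add x
  have hcont : Filter.Tendsto (fun t : ℝ => x + t • h) (𝓝 0) (𝓝 x) := by
    have := (hline 0).continuousAt.tendsto
    simpa using this
  have h1 : deriv (fun t : ℝ => ψ (x + t • h)) =ᶠ[𝓝 0] fun t => fderiv ℝ ψ (x + t • h) h := by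
    filter_upwards [hcont.eventually (hψ.eventually (by simp))] with t ht
    exact ((ht.differentiableAt (by simp)).hasFDerivAt.comp_hasDerivAt t (hline t)).deriv
  have h2 : HasDerivAt (fun t : ℝ => fderiv ℝ ψ (x + t • h) h) (fderiv ℝ (fderiv ℝ ψ) x h h) 0 := by
    have hd : HasFDerivAt (fderiv ℝ ψ) (fderiv ℝ (fderiv ℝ ψ) x) (x + (0 : ℝ) • h) := by
      rw [zero_smul, add_zero]
      exact ((hψ.fderiv_right (m := 1) (by norm_num)).differentiableAt (by simp)).hasFDerivAt
    have hd' : HasDerivAt (fun t : ℝ => fderiv ℝ ψ (x + t • h)) (fderiv ℝ (fderiv ℝ ψ) x h) 0 :=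
      HasFDerivAt.comp_hasDerivAt (f := fun t : ℝ => x + t • h) (0 : ℝ) hd (hline 0)
    simpa using hd'.clm_apply (hasDerivAt_const (0 : ℝ) h)
  rw [← h2.deriv, ← h1.deriv_eq]
  refine deriv_deriv_nonneg_of_isLocalMin ?_ ?_
  · exact ContinuousAt.comp (f := fun t : ℝ => x + t • h) (g := ψ)
      (by simpa using hψ.continuousAt) (hline 0).continuousAt
  · have := hcont.eventually hmin
    filter_upwards [this] with t ht
    simpa using ht

namespace Fan

theorem isInfinityHarmonic_of_smooth {n : ℕ} {U : Set (EuclideanSpace ℝ (Fin n))} (hU : IsOpen U)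
    {f : EuclideanSpace ℝ (Fin n) → ℝ} (hf : ContDiffOn ℝ ∞ f U)
    (h0 : ∀ x ∈ U, fderiv ℝ (fderiv ℝ f) x (gradient f x) (gradient f x) = 0) :
    IsInfinityHarmonic U f := by
  -- at a contact point the gradients agree, and the Hessians are ordered
  have key : ∀ x ∈ U, ∀ φ : EuclideanSpace ℝ (Fin n) → ℝ, ContDiffAt ℝ 2 φ x →
      fderiv ℝ (fun y => f y - φ y) x = 0 → infLaplacian φ x = -((‖gradient f x‖ ^ 2)⁻¹ *
        fderiv ℝ (fderiv ℝ fun y => f y - φ y) x (gradient f x) (gradient f x)) := by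
    intro x hx φ hφ hd
    have hfx : ContDiffAt ℝ 2 f x := contDiffAt_infty.1 (hf.contDiffAt (hU.mem_nhds hx)) 2
    have h1 : fderiv ℝ (fun y => f y - φ y) =ᶠ[𝓝 x] fun y => fderiv ℝ f y - fderiv ℝ φ y := by
      filter_upwards [hfx.eventually (by simp), hφ.eventually (by simp)] with y h1 h2
      exact fderiv_fun_sub (h1.differentiableAt (by simp)) (h2.differentiableAt (by simp))
    have h2 : fderiv ℝ (fderiv ℝ fun y => f y - φ y) x =
        fderiv ℝ (fderiv ℝ f) x - fderiv ℝ (fderiv ℝ φ) x := by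
      rw [h1.fderiv_eq]
      exact fderiv_fun_sub
        ((hfx.fderiv_right (m := 1) (by norm_num)).differentiableAt (by simp))
        ((hφ.fderiv_right (m := 1) (by norm_num)).differentiableAt (by simp))
    have h3 : gradient φ x = gradient f x := by
      have h4 := h1.eq_of_nhds
      rw [hd] at h4
      rw [gradient, gradient, ← sub_eq_zero.1 h4.symm]
    rw [infLaplacian, h3, h2, sub_apply, sub_apply, h0 x hx]
    ring
  refine ⟨hf.continuousOn, fun x hx φ hφ hmax => ?_, fun x hx φ hφ hmin => ?_⟩
  · have hfx : ContDiffAt ℝ 2 f x := contDiffAt_infty.1 (hf.contDiffAt (hU.mem_nhds hx)) 2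
    rw [key x hx φ hφ hmax.fderiv_eq_zero]
    have hneg := fderiv_fderiv_nonneg_of_isLocalMin (hfx.sub hφ).neg hmax.neg (gradient f x)
    have h1 : fderiv ℝ (fun y => -(f y - φ y)) = fun y => -fderiv ℝ (fun y => f y - φ y) y := by
      funext y
      exact fderiv_fun_neg
    have h2 : fderiv ℝ (fderiv ℝ fun y => -(f y - φ y)) x =
        -fderiv ℝ (fderiv ℝ fun y => f y - φ y) x := by
      rw [h1]
      exact fderiv_fun_neg
    change 0 ≤ fderiv ℝ (fderiv ℝ fun y => -(f y - φ y)) x _ _ at hneg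
    rw [h2, neg_apply, neg_apply] at hneg
    rw [← mul_neg]
    exact mul_nonneg (by positivity) hneg
  · have hfx : ContDiffAt ℝ 2 f x := contDiffAt_infty.1 (hf.contDiffAt (hU.mem_nhds hx)) 2
    rw [key x hx φ hφ hmin.fderiv_eq_zero]
    exact neg_nonpos.2 (mul_nonneg (by positivity)
      (fderiv_fderiv_nonneg_of_isLocalMin (hfx.sub hφ) hmin _))

/-! ### The fan presentation -/

variable {m : ℕ} {U : Set (EuclideanSpace ℝ (Fin 2))}
  {u : EuclideanSpace ℝ (Fin 2) → EuclideanSpace ℝ (Fin m)}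
  {a : EuclideanSpace ℝ (Fin 2) → EuclideanSpace ℝ (Fin 2)}

theorem constOnFlowCurves_of_dirDeriv_eq_zero (hU : IsOpen U)
    {f : EuclideanSpace ℝ (Fin 2) → ℝ} {g : EuclideanSpace ℝ (Fin 2) → EuclideanSpace ℝ (Fin m)}
    (hg : ContDiffOn ℝ ∞ g U) {c : EuclideanSpace ℝ (Fin 2) → ℝ}
    (hf : ∀ x ∈ U, gradient f x = c x • a x) (h0 : ∀ x ∈ U, dirDeriv a g x = 0) :
    ConstOnFlowCurves U f g := by
  intro I γ hI hIc hγ s hs t ht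
  have hd : ∀ r ∈ I, HasDerivAt (fun r => g (γ r)) 0 r := by
    intro r hr
    obtain ⟨hrU, hr'⟩ := hγ r hr
    have h1 := (hg.differentiableAt_of_isOpen hU hrU).hasFDerivAt.comp_hasDerivAt r hr'
    rw [hf _ hrU, map_smul] at h1
    have h2 : fderiv ℝ g (γ r) (a (γ r)) = 0 := h0 _ hrU
    rwa [h2, smul_zero] at h1
  exact hI.is_const_of_deriv_eq_zero hIc.isPreconnected
    (fun r hr => (hd r hr).differentiableAt.differentiableWithinAt) (fun r hr => (hd r hr).deriv)
    hs ht

/-- The functional `⟪b, Du ·⟫`, where `b = Du a / |Du a|`, is `|Du a| ⟪a, ·⟫`. -/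
theorem IsPrincipalDirection.inner_apply
    {L : EuclideanSpace ℝ (Fin 2) →L[ℝ] EuclideanSpace ℝ (Fin m)} {a : EuclideanSpace ℝ (Fin 2)} (h : IsPrincipalDirection L a) (v : EuclideanSpace ℝ (Fin 2)) :
    inner ℝ (‖L a‖⁻¹ • L a) (L v) = ‖L a‖ * inner ℝ a v := by
  have h0 : ‖L a‖ ≠ 0 := norm_ne_zero_iff.2 h.apply_ne_zero
  conv_lhs => rw [eq_inner_smul_add_inner_rot_smul h.norm_eq_one v]
  rw [map_add, map_smul, map_smul, inner_add_right, real_inner_smul_left, real_inner_smul_left,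
    real_inner_smul_right, real_inner_smul_right, h.inner_eq_zero, real_inner_self_eq_norm_sq]
  field_simp
  ring

set_option maxHeartbeats 1000000 in
/-- A solution of `D_a (Du a) = 0` with principal direction field `a` is a fan. With
`b = Du a / |Du a|`, the 1-form `⟪b, Du ·⟫ = |Du a| ⟪a, ·⟫` is closed: the exterior derivative
is `⟪D_h b, D_k u⟫ - ⟪D_k b, D_h u⟫`, and for `h = a`, `k ⟂ a` both terms vanish, because `D_a b = 0`
and `D_k b ⟂ b`. Its primitive is `f`. -/
theorem exists_isInfinityHarmonicFan (hU : IsOpen U) (hUsc : IsSimplyConnected U)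
    (hu : ContDiffOn ℝ ∞ u U) (ha : ContDiffOn ℝ ∞ a U) (hpdf : IsPrincipalDirectionField U u a)
    (heq : ∀ x ∈ U, dirDeriv a (dirDeriv a u) x = 0) :
    ∃ (f : EuclideanSpace ℝ (Fin 2) → ℝ)
      (b c : EuclideanSpace ℝ (Fin 2) → EuclideanSpace ℝ (Fin m)),
      IsInfinityHarmonicFan U u f b c := by
  have hp : ∀ x ∈ U, IsPrincipalDirection (fderiv ℝ u x) (a x) := fun x hx =>
    hpdf.isPrincipalDirection hx
  set p := dirDeriv a u with hpdef
  have hpS : ContDiffOn ℝ ∞ p U := contDiffOn_dirDeriv hU ha hu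
  have hpne : ∀ x ∈ U, p x ≠ 0 := fun x hx => (hp x hx).apply_ne_zero
  have hn0 : ∀ x ∈ U, ‖p x‖ ≠ 0 := fun x hx => norm_ne_zero_iff.2 (hpne x hx)
  have hinvS : ContDiffOn ℝ ∞ (fun x => ‖p x‖⁻¹) U := (hpS.norm ℝ hpne).inv hn0
  set b : EuclideanSpace ℝ (Fin 2) → EuclideanSpace ℝ (Fin m) := fun x => ‖p x‖⁻¹ • p x with hb
  have hbS : ContDiffOn ℝ ∞ b U := hinvS.smul hpS
  have hbnorm : ∀ x ∈ U, ‖b x‖ = 1 := fun x hx => by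
    rw [hb, norm_smul, norm_inv, norm_norm, inv_mul_cancel₀ (hn0 x hx)]
  have hpb : ∀ x ∈ U, p x = ‖p x‖ • b x := fun x hx => by
    rw [hb, smul_smul, mul_inv_cancel₀ (hn0 x hx), one_smul]
  have hbDb : ∀ x ∈ U, ∀ h, inner ℝ (b x) (fderiv ℝ b x h) = 0 := fun x hx h => by
    have hbd := hbS.differentiableAt_of_isOpen hU hx
    have h1 := inner_fderiv_eq_neg_of_inner_eq_const hU hx hbd hbd (c := 1)
      (fun y hy => by rw [real_inner_self_eq_norm_sq, hbnorm y hy, one_pow]) h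
    rw [real_inner_comm (b x)] at h1
    linarith
  have hDab : ∀ x ∈ U, dirDeriv a b x = 0 := by
    intro x hx
    have h1 : fderiv ℝ b x = ‖p x‖⁻¹ • fderiv ℝ p x +
        (fderiv ℝ (fun x => ‖p x‖⁻¹) x).smulRight (p x) :=
      ((hinvS.differentiableAt_of_isOpen hU hx).hasFDerivAt.fun_smul
        (hpS.differentiableAt_of_isOpen hU hx).hasFDerivAt).fderiv
    have h2 : fderiv ℝ p x (a x) = 0 := heq x hx
    -- `D_a b` is a multiple of `b`, and orthogonal to `b`
    have h3 : fderiv ℝ b x (a x) = (fderiv ℝ (fun x => ‖p x‖⁻¹) x (a x) * ‖p x‖) • b x := by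
      rw [h1, add_apply, smul_apply, h2, smul_zero, zero_add,
        ContinuousLinearMap.smulRight_apply, mul_smul, ← hpb x hx]
    have h4 := hbDb x hx (a x)
    rw [h3, real_inner_smul_right, real_inner_self_eq_norm_sq, hbnorm x hx, one_pow, mul_one] at h4
    rw [dirDeriv, h3, h4, zero_smul]
  have hDuS : ContDiffOn ℝ ∞ (fderiv ℝ u) U := hu.fderiv_of_isOpen hU (by simp)
  set θ : EuclideanSpace ℝ (Fin 2) → EuclideanSpace ℝ (Fin 2) →L[ℝ] ℝ :=
    fun x => (innerSL ℝ (b x)).comp (fderiv ℝ u x) with hθ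
  have hθS : ContDiffOn ℝ ∞ θ U :=
    ((innerSL ℝ).contDiff.comp_contDiffOn hbS).clm_comp hDuS
  have hθapp : ∀ x ∈ U, ∀ v, θ x v = ‖p x‖ * inner ℝ (a x) v := fun x hx v =>
    (hp x hx).inner_apply v
  have hdθ : ∀ x ∈ U, ∀ h k, fderiv ℝ θ x h k =
      inner ℝ (fderiv ℝ b x h) (fderiv ℝ u x k) +
        inner ℝ (b x) (fderiv ℝ (fderiv ℝ u) x h k) := by
    intro x hx h k
    have h1 : HasFDerivAt (fun y => innerSL ℝ (b y)) ((innerSL ℝ).comp (fderiv ℝ b x)) x :=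
      (innerSL ℝ).hasFDerivAt.comp x (hbS.differentiableAt_of_isOpen hU hx).hasFDerivAt
    have h2 := (h1.clm_comp (hDuS.differentiableAt_of_isOpen hU hx).hasFDerivAt).fderiv
    have h3 : fderiv ℝ θ x = _ := h2
    rw [h3]
    simp [add_comm]
  have hsymm : ∀ x ∈ U, ∀ h k, fderiv ℝ θ x h k = fderiv ℝ θ x k h := by
    intro x hx h k
    have hs : IsSymmSndFDerivAt ℝ u x :=
      (contDiffAt_infty.1 (hu.contDiffAt (hU.mem_nhds hx)) 2).isSymmSndFDerivAt (by simp)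
    rw [hdθ x hx, hdθ x hx, hs.eq h k]
    congr 1
    have hDb : ∀ v, fderiv ℝ b x v = inner ℝ (rot (a x)) v • fderiv ℝ b x (rot (a x)) := by
      intro v
      have h0 : fderiv ℝ b x (a x) = 0 := hDab x hx
      conv_lhs => rw [eq_inner_smul_add_inner_rot_smul (hp x hx).norm_eq_one v]
      rw [map_add, map_smul, map_smul, h0, smul_zero, zero_add]
    have hDu : ∀ v, inner ℝ (fderiv ℝ b x (rot (a x))) (fderiv ℝ u x v) =
        inner ℝ (rot (a x)) v *
          inner ℝ (fderiv ℝ b x (rot (a x))) (fderiv ℝ u x (rot (a x))) := by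
      intro v
      have h0 : inner ℝ (fderiv ℝ b x (rot (a x))) (fderiv ℝ u x (a x)) = 0 := by
        change inner ℝ _ (p x) = 0
        rw [hpb x hx, real_inner_smul_right, real_inner_comm, hbDb x hx, mul_zero]
      conv_lhs => rw [eq_inner_smul_add_inner_rot_smul (hp x hx).norm_eq_one v]
      rw [map_add, map_smul, map_smul, inner_add_right, real_inner_smul_right,
        real_inner_smul_right, h0, mul_zero, zero_add]
    rw [hDb h, hDb k, real_inner_smul_left, real_inner_smul_left, hDu h, hDu k]
    ring
  obtain ⟨f, hf⟩ := exists_hasFDerivAt_of_isSimplyConnected hU hUsc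
    (fun x hx => (hθS.differentiableAt_of_isOpen hU hx).differentiableWithinAt) hsymm
  have hfS : ContDiffOn ℝ ∞ f U := (contDiffOn_infty_iff_fderiv_of_isOpen hU).2
    ⟨fun x hx => (hf x hx).differentiableAt.differentiableWithinAt,
      hθS.congr fun x hx => (hf x hx).fderiv⟩
  have hgrad : ∀ x ∈ U, gradient f x = ‖p x‖ • a x := by
    intro x hx
    refine HasGradientAt.gradient (hasGradientAt_iff_hasFDerivAt.2 ?_)
    convert! hf x hx using 1
    ext v
    rw [hθapp x hx]
    simp
  have hgradn : ∀ x ∈ U, ‖gradient f x‖⁻¹ • gradient f x = a x := by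
    intro x hx
    rw [hgrad x hx, norm_smul, norm_norm, (hp x hx).norm_eq_one, mul_one, smul_smul,
      inv_mul_cancel₀ (hn0 x hx), one_smul]
  have hD2f : ∀ x ∈ U, fderiv ℝ (fderiv ℝ f) x (gradient f x) (gradient f x) = 0 := by
    intro x hx
    have h1 : fderiv ℝ f =ᶠ[𝓝 x] θ := by
      filter_upwards [hU.mem_nhds hx] with y hy using (hf y hy).fderiv
    have had := ha.differentiableAt_of_isOpen hU hx
    -- differentiate `Du a` in the direction `a`
    have h2 : fderiv ℝ (fderiv ℝ u) x (a x) (a x) = -fderiv ℝ u x (fderiv ℝ a x (a x)) := by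
      have h3 := ((hDuS.differentiableAt_of_isOpen hU hx).hasFDerivAt.clm_apply
        had.hasFDerivAt).fderiv
      have h4 : fderiv ℝ p x (a x) = 0 := heq x hx
      have h5 : fderiv ℝ p x = _ := h3
      rw [h5] at h4
      simp only [add_apply, ContinuousLinearMap.comp_apply, ContinuousLinearMap.flip_apply] at h4
      exact eq_neg_of_add_eq_zero_right h4
    have h6 : inner ℝ (a x) (fderiv ℝ a x (a x)) = 0 := by
      have h7 := inner_fderiv_eq_neg_of_inner_eq_const hU hx had had (c := 1)
        (fun y hy => by rw [real_inner_self_eq_norm_sq, (hp y hy).norm_eq_one, one_pow]) (a x)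
      rw [real_inner_comm (a x)] at h7
      linarith
    have h8 : inner ℝ (b x) (fderiv ℝ u x (fderiv ℝ a x (a x))) = 0 := by
      have := hθapp x hx (fderiv ℝ a x (a x))
      rw [h6, mul_zero] at this
      exact this
    have h9 : fderiv ℝ b x (a x) = 0 := hDab x hx
    rw [h1.fderiv_eq, hgrad x hx]
    simp only [map_smul, smul_apply]
    rw [hdθ x hx, h9, h2, inner_neg_right, h8, inner_zero_left]
    simp
  set c : EuclideanSpace ℝ (Fin 2) → EuclideanSpace ℝ (Fin m) := fun x => u x - f x • b x with hc
  have hcS : ContDiffOn ℝ ∞ c U := hu.sub (hfS.smul hbS)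
  have hDac : ∀ x ∈ U, dirDeriv a c x = 0 := by
    intro x hx
    have h1 : fderiv ℝ c x = fderiv ℝ u x - (f x • fderiv ℝ b x + (θ x).smulRight (b x)) :=
      ((hu.differentiableAt_of_isOpen hU hx).hasFDerivAt.fun_sub
        ((hf x hx).fun_smul (hbS.differentiableAt_of_isOpen hU hx).hasFDerivAt)).fderiv
    have h2 : fderiv ℝ b x (a x) = 0 := hDab x hx
    rw [dirDeriv, h1]
    simp only [sub_apply, add_apply, smul_apply, ContinuousLinearMap.smulRight_apply]
    rw [h2, hθapp x hx, real_inner_self_eq_norm_sq, (hp x hx).norm_eq_one, smul_zero, zero_add,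
      one_pow, mul_one, ← hpb x hx]
    exact sub_self _
  refine ⟨f, b, c, ?_, hfS, isInfinityHarmonic_of_smooth hU hfS hD2f, hbS, hbnorm,
    constOnFlowCurves_of_dirDeriv_eq_zero hU hbS hgrad hDab, hcS,
    constOnFlowCurves_of_dirDeriv_eq_zero hU hcS hgrad hDac, ?_, ?_, ?_⟩
  · intro x _
    simp [hc]
  · exact ha.continuousOn.congr fun x hx => hgradn x hx
  · intro x hx
    simp only [hgradn x hx, (hp x hx).norm_eq_one]
  · intro x hx
    simp only [hgradn x hx]
    exact hpdf.spans x hx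

end Fan

theorem mainTheorem6 (m : ℕ) (U : Set (EuclideanSpace ℝ (Fin 2))) (hU_open : IsOpen U)
    (hU_bounded : Bornology.IsBounded U) (hU_sc : IsSimplyConnected U)
    (u : EuclideanSpace ℝ (Fin 2) → EuclideanSpace ℝ (Fin m))
    (hu_smooth : ContDiffOn ℝ ∞ u U) (hu_tight : Fan.IsTight U u)
    (a : EuclideanSpace ℝ (Fin 2) → EuclideanSpace ℝ (Fin 2))
    (ha_smooth : ContDiffOn ℝ ∞ a U) (ha : Fan.IsPrincipalDirectionField U u a) :
    ∃ (f : EuclideanSpace ℝ (Fin 2) → ℝ)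
      (b c : EuclideanSpace ℝ (Fin 2) → EuclideanSpace ℝ (Fin m)),
      Fan.IsInfinityHarmonicFan U u f b c :=
  Fan.exists_isInfinityHarmonicFan hU_open hU_sc hu_smooth ha_smooth ha fun _ hx =>
    Fan.dirDeriv_dirDeriv_eq_zero hU_open hu_smooth ha_smooth
      (fun _ hy => ha.isPrincipalDirection hy) hu_tight hx
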